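/- Let $p$ be a prime, $r\ge 1$, let $x_1,\dots,x_r\in\mathbb C$ be distinct, and let $v_1,\dots,v_r$ be integers with $0<v_i<p$ and $\sum_i v_i\equiv 0 \bmod p$. Put $\Sigma=\mathbb C(x)$, $f=\prod_i (x-x_i)^{v_i}$ and $\Omega=\Sigma[y]/(y^p-f)$ (a field), and let $\pi:Y\to\mathbb P^1$, $(x,y)\mapsto x$, be the compact Riemann surface (smooth projective curve) with function field $\Omega$, i.e. the normalization of $y^p=f(x)$. Let $\chi:\mathcal C_p\to\mu_p\subset\mathbb C^*$ be a nontrivial character of the cyclic group $\mathcal C_p=\mathbb Z/(p)$, let $\mathcal C_p$ act on $\Omega$ over $\Sigma$ (and so on $Y$ over $\mathbb P^1$) by $g(y)=\chi(g)y$, let $\zeta$ be a primitive $p$th root of unity, and let $\tau\in\mathcal C_p$ satisfy $\chi(\tau)=\zeta$, so that $\tau:(x,y)\mapsto(x,\zeta y)$. For $x=x_i$ let $K_x$ be the completion of $\Sigma$ at $x$, with normalized valuation $\upsilon_x$, let $E_x=K_x\otimes_\Sigma\Omega$, let $\tau_x=\mathrm{id}\otimes\tau$, and for $\lambda\in K_x^*$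 let $\langle\tau_x,\lambda\rangle_x=\tau_x(\lambda^{1/p})/\lambda^{1/p}$ be the Kummer symbol, where $\lambda^{1/p}$ is any $p$th root of $\lambda$ in $E_x$. Then for every $i$, with $x=x_i$: 1. $E_x$ is a field, there is exactly one point $P_x\in Y$ over $x$, and $\upsilon_x(f)=v_i$. 2. For every uniformizer $z_x$ of $K_x$ there is a $p$th root of $z_x$ in $E_x$, and the symbol $\langle\tau_x,z_x\rangle_x$ is a well-defined $p$th root of unity. Its discrete logarithm, the algebraic rotation number $\rho_x=\log_\zeta\langle\tau_x,z_x\rangle_x\in\mathbb Z/(p)$, does not depend on $z_x$ and is the inverse of $v_i$ modulo $p$: $\rho_x v_i\equiv 1\bmod p$. 3. There is a holomorphic coordinate on a $\tau$-stable neighbourhood of $P_x$, identifying it with a disk centred at $0$ and $P_x$ with $0$, in which $\tau$ is $w\mapsto\zeta^{\rho_x}w$; and $\rho_x$ is the only $m\in\mathbb Z/(p)$ for which $\tau$ can be written as $w\mapsto\zeta^m w$ in such a coordinate. 4. In particular, if $\zeta=e^{2\pi i/p}$, then the algebraic rotation number $\rho_x$ is the classical analytic rotation number of $\tau$ at $P_x$: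 the unique $m \in\mathbb Z/(p)$ such that $\tau$ rotates a small disk around $P_x$ by the angle $2\pi m/p$. -/

import Mathlib

open Polynomial
open scoped TensorProduct WithZero

noncomputable section

/-! ### The compact Riemann surface of a function field over `ℂ` -/

/-- A point of the Zariski–Riemann variety of a field `F` over `ℂ`: a nontrivial valuation ring
of `F` containing `ℂ`. When `F` is a function field in one variable, these are the points of the
smooth projective curve with function field `F`. -/
structure Place (F : Type*) [Field F] [Algebra ℂ F] where
  ring : ValuationSubring F
  algebraMap_mem : ∀ c : ℂ, algebraMap ℂ F c ∈ ring
  ne_top : ring ≠ ⊤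

namespace Place

variable {F : Type*} [Field F] [Algebra ℂ F]

/-- `P.HasValue g c`: the function `g` is regular at `P`, with value `c` there, that is, `g - c`
lies in the maximal ideal of the valuation ring. -/
def HasValue (P : Place F) (g : F) (c : ℂ) : Prop :=
  g - algebraMap ℂ F c ∈ P.ring.nonunits

open Classical in
/-- The value `g(P)` as a complex number (`0` if `g` has no finite value at `P`). -/
def value (P : Place F) (g : F) : ℂ :=
  if h : ∃ c, P.HasValue g c then h.choose else 0

open Classical in
/-- The value `g(P)` in the Riemann sphere `ℂ ∪ {∞}`. -/
def sphereValue (P : Place F) (g : F) : OnePoint ℂ :=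
  if h : ∃ c, P.HasValue g c then (h.choose : OnePoint ℂ) else OnePoint.infty

/-- The analytic topology: the coarsest one for which every element of `F` is a continuous
function to the Riemann sphere. -/
instance : TopologicalSpace (Place F) :=
  ⨅ g : F, TopologicalSpace.induced (fun P => P.sphereValue g) inferInstance

/-- A homeomorphism from an open set of points to an open subset of `ℂ` is a holomorphic
coordinate if every element of `F` is, as a function of the coordinate, analytic at each point
where it is regular. -/
def IsHolomorphicChart (φ : OpenPartialHomeomorph (Place F) ℂ) : Prop :=
  ∀ g : F, ∀ w ∈ φ.target, g ∈ (φ.symm w).ring →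
    AnalyticAt ℂ (fun w' => (φ.symm w').value g) w

/-- The map on points induced by an automorphism `τ` of the function field, characterised by
`g (τ P) = (τ g) (P)`. -/
def map (τ : F ≃ₐ[ℂ] F) (P : Place F) : Place F where
  ring := P.ring.comap (τ : F →+* F)
  algebraMap_mem c := by
    have h := P.algebraMap_mem c
    simpa [ValuationSubring.mem_comap] using h
  ne_top h := P.ne_top <| by
    ext g
    refine ⟨fun _ => trivial, fun _ => ?_⟩
    have : τ.symm g ∈ P.ring.comap (τ : F →+* F) := by rw [h]; trivial
    simpa [ValuationSubring.mem_comap] using this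

/-- Around `P` the automorphism `τ` is multiplication by `c` on a disk: some holomorphic coordinate
identifies a neighbourhood of `P` that is mapped into itself by `τ` with a disk centred at `0`,
sends `P` to `0`, and turns `τ` into `w ↦ c * w`. -/
def ActsOnDiskBy (τ : F ≃ₐ[ℂ] F) (P : Place F) (c : ℂ) : Prop :=
  ∃ φ : OpenPartialHomeomorph (Place F) ℂ, IsHolomorphicChart φ ∧
    P ∈ φ.source ∧ φ P = 0 ∧ (∃ ε > 0, φ.target = Metric.ball 0 ε) ∧
    ∀ Q ∈ φ.source, map τ Q ∈ φ.source ∧ φ (map τ Q) = c * φ Q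

/-- The classical analytic rotation number modulo `p`: around `P` the automorphism `τ` rotates a
small disk by the angle `2 π ρ / p`. -/
def IsAnalyticRotationNumber (p : ℕ) (τ : F ≃ₐ[ℂ] F) (P : Place F) (ρ : ZMod p) : Prop :=
  ActsOnDiskBy τ P (Complex.exp (2 * Real.pi * Complex.I * (ρ.val : ℂ) / (p : ℂ)))

end Place

/-! ### Local Kummer symbols -/

/-- The Kummer symbol `⟨g, a⟩ = g (a^{1/p}) / a^{1/p}` is `c`: the element `a` of `K` has a `p`-th
root in the extension `E`, and `g` multiplies every such root by `c`. -/
def IsKummerSymbol {K E : Type*} [Field K] [CommRing E] [Algebra K E] (p : ℕ)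
    (g : E ≃ₐ[K] E) (a c : K) : Prop :=
  (∃ β : E, β ^ p = algebraMap K E a) ∧
    ∀ β : E, β ^ p = algebraMap K E a → g β = algebraMap K E c * β

/-! ### Superelliptic covers of the projective line -/

/-- The data of the superelliptic equation `y ^ p = ∏ i, (x - x_i) ^ v_i`. -/
structure SuperellipticDatum (p : ℕ) where
  r : ℕ
  r_pos : 0 < r
  pt : Fin r → ℂ
  pt_injective : Function.Injective pt
  v : Fin r → ℕ
  v_pos : ∀ i, 0 < v i
  v_lt : ∀ i, v i < p
  dvd_sum : p ∣ ∑ i, v i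

namespace SuperellipticDatum

variable {p : ℕ} (S : SuperellipticDatum p)

/-- The right-hand side `f` as a polynomial in `x`. -/
def rhsPoly : ℂ[X] := ∏ i, (X - C (S.pt i)) ^ S.v i

/-- The right-hand side `f` as an element of `Σ = ℂ(x)`. -/
def rhs : RatFunc ℂ := algebraMap ℂ[X] (RatFunc ℂ) S.rhsPoly

/-- The polynomial `T ^ p - f` over `ℂ(x)`. -/
def eqn : (RatFunc ℂ)[X] := X ^ p - C S.rhs

/-- The algebra `Ω_f = ℂ(x)[y] / (y ^ p - f)`. -/
abbrev FunctionField : Type := AdjoinRoot S.eqn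

/-- The function `y` on the curve. -/
def y : S.FunctionField := AdjoinRoot.root S.eqn

theorem y_pow : S.y ^ p = algebraMap (RatFunc ℂ) S.FunctionField S.rhs := by
  have h : eval₂ (AdjoinRoot.of S.eqn) S.y (X ^ p - C S.rhs) = 0 := AdjoinRoot.eval₂_root S.eqn
  simp only [eval₂_sub, eval₂_pow, eval₂_X, eval₂_C, sub_eq_zero] at h
  exact h

theorem rhs_ne_pow (hp : p.Prime) (b : RatFunc ℂ) : b ^ p ≠ S.rhs := by
  intro h
  obtain ⟨q, rfl⟩ := IsIntegrallyClosed.exists_algebraMap_eq_of_isIntegral_pow (R := ℂ[X])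
    (x := b) hp.pos (by rw [h]; exact isIntegral_algebraMap)
  rw [rhs, ← map_pow] at h
  have h1 : q ^ p = S.rhsPoly := IsFractionRing.injective ℂ[X] (RatFunc ℂ) h
  have hne : ∀ i, (X - C (S.pt i)) ^ S.v i ≠ 0 := fun i => pow_ne_zero _ (X_sub_C_ne_zero _)
  have h2 := congrArg (fun s => s.roots.count (S.pt ⟨0, S.r_pos⟩)) h1
  simp only [rhsPoly, roots_pow, Multiset.count_nsmul] at h2
  rw [roots_prod _ _ (Finset.prod_ne_zero_iff.mpr fun i _ => hne i), Multiset.count_bind] at h2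
  simp only [roots_pow, roots_X_sub_C, Multiset.count_nsmul, Multiset.count_singleton,
    S.pt_injective.eq_iff] at h2
  have h3 : p * q.roots.count (S.pt ⟨0, S.r_pos⟩) = S.v ⟨0, S.r_pos⟩ := by
    rw [h2]
    change ∑ i, _ = _
    simp
  exact Nat.not_dvd_of_pos_of_lt (S.v_pos _) (S.v_lt _) ⟨_, h3.symm⟩

instance [hp : Fact p.Prime] : Fact (Irreducible S.eqn) :=
  ⟨X_pow_sub_C_irreducible_of_prime hp.out (S.rhs_ne_pow hp.out)⟩

/-- The `ℂ(x)`-algebra endomorphism `y ↦ c y` of `Ω_f`, for a `p`-th root of unity `c`. -/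
def kummerHom (c : rootsOfUnity p ℂ) : S.FunctionField →ₐ[RatFunc ℂ] S.FunctionField :=
  AdjoinRoot.liftAlgHom S.eqn (Algebra.ofId _ _)
    (algebraMap (RatFunc ℂ) S.FunctionField (RatFunc.C ((c : ℂˣ) : ℂ)) * S.y) <| by
      have hc : (((c : ℂˣ) : ℂ)) ^ p = 1 := by
        have := (mem_rootsOfUnity p (c : ℂˣ)).1 c.2
        simpa using congrArg Units.val this
      simp only [eqn, eval₂_sub, eval₂_pow, eval₂_X, eval₂_C, mul_pow, S.y_pow]
      rw [← map_pow, ← map_pow, hc]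
      simp

theorem kummerHom_y (c : rootsOfUnity p ℂ) : S.kummerHom c S.y =
    algebraMap (RatFunc ℂ) S.FunctionField (RatFunc.C ((c : ℂˣ) : ℂ)) * S.y := by
  simp [kummerHom, y]

theorem kummerHom_one : S.kummerHom 1 = AlgHom.id (RatFunc ℂ) S.FunctionField := by
  apply AdjoinRoot.algHom_ext
  change S.kummerHom 1 S.y = S.y
  simp [kummerHom_y]

theorem kummerHom_mul (c d : rootsOfUnity p ℂ) :
    S.kummerHom (c * d) = (S.kummerHom c).comp (S.kummerHom d) := by
  apply AdjoinRoot.algHom_ext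
  change S.kummerHom (c * d) S.y = S.kummerHom c (S.kummerHom d S.y)
  simp only [kummerHom_y, map_mul, AlgHom.commutes, Subgroup.coe_mul, Units.val_mul]
  ring

/-- The action of the cyclic group of order `p` on `Ω_f` through a character `χ`, given by
`g (y) = χ(g) y`. -/
def galoisAction (χ : Multiplicative (ZMod p) →* rootsOfUnity p ℂ) :
    Multiplicative (ZMod p) →* (S.FunctionField ≃ₐ[RatFunc ℂ] S.FunctionField) where
  toFun g := AlgEquiv.ofAlgHom (S.kummerHom (χ g)) (S.kummerHom (χ g⁻¹))
    (by rw [← kummerHom_mul, ← map_mul, mul_inv_cancel, map_one, kummerHom_one])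
    (by rw [← kummerHom_mul, ← map_mul, inv_mul_cancel, map_one, kummerHom_one])
  map_one' := by
    ext a
    simp [kummerHom_one]
  map_mul' g h := by
    ext a
    simp [kummerHom_mul]

/-- The covering map `Y → ℙ¹`, `(x, y) ↦ x`, on the Riemann surface `Y` of `Ω_f`. -/
def proj [Fact p.Prime] (P : Place S.FunctionField) : OnePoint ℂ :=
  P.sphereValue (algebraMap (RatFunc ℂ) S.FunctionField RatFunc.X)

/-- The point `x_i` of the projective line, as a prime of `ℂ[x]`. -/
def prime (i : Fin S.r) : IsDedekindDomain.HeightOneSpectrum ℂ[X] where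
  asIdeal := Ideal.span {X - C (S.pt i)}
  isPrime := (Ideal.span_singleton_prime (X_sub_C_ne_zero _)).2 (prime_X_sub_C _)
  ne_bot := by
    rw [Ne, Ideal.span_singleton_eq_bot]
    exact X_sub_C_ne_zero _

/-- The completion `K_x` of `ℂ(x)` at the point `x_i`. -/
abbrev LocalField (i : Fin S.r) : Type :=
  (S.prime i).adicCompletion (RatFunc ℂ)

/-- The fibre `E_x = K_x ⊗ Ω_f` of the cover over the completion at `x_i`. -/
abbrev LocalExtension (i : Fin S.r) : Type :=
  S.LocalField i ⊗[RatFunc ℂ] S.FunctionField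

/-- The automorphism `τ_x = id ⊗ τ` of `E_x` over `K_x` induced by `τ`. -/
def localAut (i : Fin S.r) (τ : S.FunctionField ≃ₐ[RatFunc ℂ] S.FunctionField) :
    S.LocalExtension i ≃ₐ[S.LocalField i] S.LocalExtension i :=
  Algebra.TensorProduct.congr AlgEquiv.refl τ

/-- `z` is a uniformizer of `K_x`. -/
def IsUniformizer (i : Fin S.r) (z : S.LocalField i) : Prop :=
  Valued.v z = WithZero.exp (-1 : ℤ)

/-- The algebraic rotation number `log_ζ ⟨τ_x, z⟩_x` at `x_i` is `ρ`, that is, the local Kummer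
symbol `⟨τ_x, z⟩_x` equals `ζ ^ ρ`. -/
def IsAlgebraicRotationNumber (i : Fin S.r)
    (τ : S.FunctionField ≃ₐ[RatFunc ℂ] S.FunctionField) (ζ : ℂ) (z : S.LocalField i)
    (ρ : ZMod p) : Prop :=
  IsKummerSymbol p (S.localAut i τ) z
    (algebraMap (RatFunc ℂ) (S.LocalField i) (RatFunc.C (ζ ^ ρ.val)))

end SuperellipticDatum

end

/-! Fix `x_i` and choose `a = S.invExp i`, `k = S.quoExp i` with `a * v_i = 1 + p * k`. The function
`u = y ^ a / (x - x_i) ^ k` (`unif`) computes both the algebraic and the analytic rotation number: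
`τ u = ζ ^ a u`, and `a` represents the inverse of `v_i` modulo `p`.

Analytic side. Let `H` be a holomorphic `p`-th root of `f / (x - x_i) ^ v_i` near `x_i`. Putting `x
= x_i + t ^ p` and `y = t ^ v_i * H (t ^ p)` embeds `Ω` in the quotients of holomorphic functions on
a disk, so each `t` defines a place. The Galois group permutes transitively the places with a given
value of `x`, and it acts on this family by rotations of `t` (`embed_apply`). Hence the family
contains every place over a small disk around `x_i` (`exists_eq_point`). So `t` is a chart in which
`τ` is `t ↦ ζ ^ a t`, and over `x_i` there is only `t = 0`. Any other chart linearizing `τ` has the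
same multiplier, by comparing derivatives at the fixed point (`eq_of_conj_mul`).

Algebraic side. `E_x` is a field because `v_i` is prime to `p`, so `f` has no `p`-th root in `K_x`.
The power `u ^ p` is a uniformizer of `K_x`. Any other uniformizer differs from it by a unit, which
is a `p`-th power by Hensel's lemma since the residue field is `ℂ`. A `p`-th root lying in `K_x` is
fixed by `τ_x`, so every uniformizer has symbol `ζ ^ a`. -/

noncomputable section

/-! ### Valuation rings over a Dedekind domain and Galois conjugacy -/

namespace ValuationSubring

/-- Two valuation subrings of the fraction field of a Dedekind domain that contain the domain and
have the same nonzero centre on it are equal. -/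
theorem eq_of_center_eq {B L : Type*} [CommRing B] [IsDedekindDomain B] [Field L] [Algebra B L]
    [IsFractionRing B L] (V W : ValuationSubring L) (hV : ∀ b : B, algebraMap B L b ∈ V)
    (hW : ∀ b : B, algebraMap B L b ∈ W)
    (h : ∀ b : B, algebraMap B L b ∈ V.nonunits ↔ algebraMap B L b ∈ W.nonunits)
    {b₀ : B} (hb₀ : b₀ ≠ 0) (hb₀V : algebraMap B L b₀ ∈ V.nonunits) : V = W := by
  let P : Ideal B :=
    (IsLocalRing.maximalIdeal V).comap ((algebraMap B L).codRestrict V.toSubring hV)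
  have memP : ∀ b, b ∈ P ↔ algebraMap B L b ∈ V.nonunits := fun b =>
    (V.coe_mem_nonunits_iff (a := ⟨algebraMap B L b, hV b⟩)).symm
  let v : IsDedekindDomain.HeightOneSpectrum B :=
    ⟨P, Ideal.IsPrime.comap _, fun hbot => hb₀ <| by
      have : b₀ ∈ P := (memP _).2 hb₀V
      rwa [hbot, Ideal.mem_bot] at this⟩
  -- Every valuation ring containing `B` with centre `P` is the localization of `B` at `P`, so it is
  -- determined by `P`.
  have key : ∀ U : ValuationSubring L, (∀ b : B, algebraMap B L b ∈ U) →
      (∀ b, b ∈ P ↔ algebraMap B L b ∈ U.nonunits) → ∀ x : L, x ∈ U ↔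
        ∃ n d : B, d ∉ P ∧ x * algebraMap B L d = algebraMap B L n := by
    intro U hU hPU x
    have unit : ∀ d : B, d ∉ P → algebraMap B L d ≠ 0 ∧ (algebraMap B L d)⁻¹ ∈ U := by
      intro d hd
      rw [hPU, U.mem_nonunits_iff_or, not_or, not_not] at hd
      exact hd
    constructor
    · intro hx
      -- Either `x` or its inverse has a denominator outside `P`. In the second case `x * n = d`
      -- with `x ∈ U`, so `n ∈ P` would force `d ∈ P`.
      obtain ⟨n, ⟨d, hd⟩, h1 | h1⟩ := v.exists_primeCompl_mul_eq_or_mul_eq x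
      · exact ⟨n, d, hd, h1⟩
      · refine ⟨d, n, fun hn => hd ?_, h1⟩
        change d ∈ P
        rw [hPU] at hn ⊢
        change x * _ = algebraMap B L d at h1
        rw [← h1, U.mem_nonunits_iff, map_mul]
        exact mul_lt_one_of_nonneg_of_lt_one_right ((U.valuation_le_one_iff x).2 hx) zero_le
          ((U.mem_nonunits_iff).1 hn)
    · rintro ⟨n, d, hd, h1⟩
      obtain ⟨h2, h3⟩ := unit d hd
      rw [eq_div_of_mul_eq h2 h1, div_eq_mul_inv]
      exact U.mul_mem _ _ (hU n) h3
  ext x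
  rw [key V hV memP, key W hW fun b => (memP b).trans (h b)]

/-- Valuation subrings of a finite Galois extension `L / K` with the same nonzero centre on a
Dedekind domain with fraction field `K` are conjugate. -/
theorem exists_comap_eq_of_center_eq {A K L : Type*} [CommRing A] [IsDedekindDomain A] [Field K]
    [Field L] [Algebra A K] [IsFractionRing A K] [Algebra K L] [Algebra A L]
    [IsScalarTower A K L] [FiniteDimensional K L] [IsGalois K L] (V W : ValuationSubring L)
    (hV : ∀ a : A, algebraMap A L a ∈ V) (hW : ∀ a : A, algebraMap A L a ∈ W)
    (h : ∀ a : A, algebraMap A L a ∈ V.nonunits ↔ algebraMap A L a ∈ W.nonunits)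
    {a₀ : A} (ha₀ : a₀ ≠ 0) (ha₀V : algebraMap A L a₀ ∈ V.nonunits) :
    ∃ σ : L ≃ₐ[K] L, W = V.comap (σ : L →+* L) := by
  let B := integralClosure A L
  have : IsDedekindDomain B := integralClosure.isDedekindDomain A K L
  have : IsFractionRing B L := integralClosure.isFractionRing_of_finite_extension K L
  let := IsIntegralClosure.MulSemiringAction A K L B
  have : Algebra.IsInvariant A B Gal(L/K) := Algebra.isInvariant_of_isGalois A K L B
  have : SMulCommClass Gal(L/K) A B := ⟨fun g a b => map_smul (galRestrict A K L B g) a b⟩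
  -- A valuation ring is integrally closed, so it contains the integral closure `B` of `A`. The two
  -- rings thus have centres on `B` lying over the same prime of `A`, and the Galois group is
  -- transitive on such primes.
  have hB : ∀ U : ValuationSubring L, (∀ a : A, algebraMap A L a ∈ U) →
      ∀ b : B, algebraMap B L b ∈ U := by
    intro U hU b
    obtain ⟨f, hf, hfb⟩ := b.2
    let j : A →+* U := (algebraMap A L).codRestrict U.toSubring hU
    have : IsIntegral U (b : L) := ⟨f.map j, hf.map j, by rw [eval₂_map]; exact hfb⟩
    obtain ⟨u, hu⟩ := IsIntegrallyClosed.algebraMap_eq_of_integral this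
    change (b : L) ∈ U
    rw [← hu]
    exact u.2
  let ctr : ∀ U : ValuationSubring L, (∀ a : A, algebraMap A L a ∈ U) → Ideal B := fun U hU =>
    (IsLocalRing.maximalIdeal U).comap ((algebraMap B L).codRestrict U.toSubring (hB U hU))
  have mem_ctr : ∀ U hU (b : B), b ∈ ctr U hU ↔ algebraMap B L b ∈ U.nonunits := fun U hU b =>
    (U.coe_mem_nonunits_iff (a := ⟨algebraMap B L b, hB U hU b⟩)).symm
  have prime_ctr : ∀ U hU, (ctr U hU).IsPrime := fun U hU => Ideal.IsPrime.comap _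
  have := prime_ctr V hV
  have := prime_ctr W hW
  obtain ⟨g, hg⟩ := Algebra.IsInvariant.exists_smul_of_under_eq A B Gal(L/K) (ctr W hW) (ctr V hV)
    (by
      ext a
      exact (mem_ctr W hW _).trans ((h a).symm.trans (mem_ctr V hV (algebraMap A B a)).symm))
  have hgB : ∀ b : B, algebraMap B L (g • b) = g (algebraMap B L b) := fun b =>
    algebraMap_galRestrict_apply A g b
  refine ⟨g, eq_of_center_eq (B := B) W _ (hB W hW) (fun b => ?_) (fun b => ?_)
    (b₀ := algebraMap A B a₀) ?_ ?_⟩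
  · rw [mem_comap]
    change g (algebraMap B L b) ∈ V
    rw [← hgB]
    exact hB V hV _
  · have e : algebraMap B L b ∈ (V.comap (g : L →+* L)).nonunits ↔
        g (algebraMap B L b) ∈ V.nonunits := by
      rw [mem_nonunits_iff_or, mem_nonunits_iff_or, mem_comap]
      simp
    rw [e, ← hgB, ← mem_ctr W hW, ← mem_ctr V hV, hg, Ideal.smul_mem_pointwise_smul_iff]
  · intro h0
    have h1 : algebraMap A L a₀ = 0 := congrArg (algebraMap B L) h0
    rw [IsScalarTower.algebraMap_apply A K L, map_eq_zero] at h1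
    exact ha₀ ((map_eq_zero_iff _ (IsFractionRing.injective A K)).1 h1)
  · rw [← IsScalarTower.algebraMap_apply]
    exact (h _).1 ha₀V

end ValuationSubring

/-! ### Values of functions at a place, and the analytic topology -/

namespace Place

variable {F : Type*} [Field F] [Algebra ℂ F] {P : Place F}

theorem ext_ring {P Q : Place F} (h : P.ring = Q.ring) : P = Q := by
  cases P; cases Q; congr

theorem algebraMap_mem_nonunits {c : ℂ} : algebraMap ℂ F c ∈ P.ring.nonunits ↔ c = 0 := by
  rw [P.ring.mem_nonunits_iff_or, ← map_inv₀, map_eq_zero]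
  exact or_iff_left (not_not.2 (P.algebraMap_mem _))

/-- The difference of two values is a constant in the maximal ideal, and nonzero constants are
units. -/
theorem HasValue.eq {g : F} {c d : ℂ} (hc : P.HasValue g c) (hd : P.HasValue g d) : c = d := by
  have h := sub_mem hd hc
  rwa [sub_sub_sub_cancel_left, ← map_sub, algebraMap_mem_nonunits, sub_eq_zero] at h

theorem HasValue.mem {g : F} {c : ℂ} (h : P.HasValue g c) : g ∈ P.ring := by
  have := add_mem (P.ring.nonunits_subset h) (P.algebraMap_mem c)
  rwa [sub_add_cancel] at this

theorem HasValue.value_eq {g : F} {c : ℂ} (h : P.HasValue g c) : P.value g = c := by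
  have hex : ∃ c, P.HasValue g c := ⟨c, h⟩
  rw [value, dif_pos hex]
  exact hex.choose_spec.eq h

theorem sphereValue_eq_coe_iff {g : F} {c : ℂ} :
    P.sphereValue g = (c : OnePoint ℂ) ↔ P.HasValue g c := by
  unfold sphereValue
  split_ifs with h
  · rw [OnePoint.coe_eq_coe]
    exact ⟨fun e => e ▸ h.choose_spec, fun h' => h.choose_spec.eq h'⟩
  · exact ⟨fun e => absurd e (OnePoint.infty_ne_coe c), fun h' => absurd ⟨c, h'⟩ h⟩

theorem sphereValue_eq_infty {g : F} (h : g ∉ P.ring) : P.sphereValue g = OnePoint.infty := by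
  unfold sphereValue
  rw [dif_neg]
  rintro ⟨c, hc⟩
  exact h hc.mem

theorem hasValue_algebraMap (c : ℂ) : P.HasValue (algebraMap ℂ F c) c := by
  rw [HasValue, sub_self]
  exact P.ring.nonunits.zero_mem

theorem mul_mem_nonunits {a b : F} (ha : a ∈ P.ring) (hb : b ∈ P.ring.nonunits) :
    a * b ∈ P.ring.nonunits := by
  rw [P.ring.mem_nonunits_iff, map_mul]
  exact mul_lt_one_of_nonneg_of_lt_one_right ((P.ring.valuation_le_one_iff a).2 ha) zero_le hb

theorem HasValue.mul {g g' : F} {c c' : ℂ} (h : P.HasValue g c) (h' : P.HasValue g' c') :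
    P.HasValue (g * g') (c * c') := by
  have e : g * g' - algebraMap ℂ F (c * c') =
      g * (g' - algebraMap ℂ F c') + algebraMap ℂ F c' * (g - algebraMap ℂ F c) := by
    rw [map_mul]; ring
  rw [HasValue, e]
  exact add_mem (mul_mem_nonunits h.mem h') (mul_mem_nonunits (P.algebraMap_mem c') h)

theorem HasValue.add {g g' : F} {c c' : ℂ} (h : P.HasValue g c) (h' : P.HasValue g' c') :
    P.HasValue (g + g') (c + c') := by
  rw [HasValue, map_add, add_sub_add_comm]
  exact add_mem h h'

theorem HasValue.aeval {g : F} {c : ℂ} (h : P.HasValue g c) (q : ℂ[X]) :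
    P.HasValue (Polynomial.aeval g q) (q.eval c) := by
  induction q using Polynomial.induction_on with
  | C a => simpa using hasValue_algebraMap a
  | add q r hq hr => simpa using hq.add hr
  | monomial n a hn => simpa [pow_succ, mul_assoc] using hn.mul h

theorem hasValue_zero {g : F} : P.HasValue g 0 ↔ g ∈ P.ring.nonunits := by
  rw [HasValue, map_zero, sub_zero]

theorem hasValue_inv_zero {g : F} (hg : g ≠ 0) : P.HasValue g⁻¹ 0 ↔ g ∉ P.ring := by
  rw [HasValue, map_zero, sub_zero, ValuationSubring.inv_mem_nonunits_iff, or_iff_right hg]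

theorem HasValue.of_inv {g : F} {c : ℂ} (h : P.HasValue g⁻¹ c) (hc : c ≠ 0) :
    P.HasValue g c⁻¹ := by
  have hg0 : g ≠ 0 := by
    rintro rfl
    rw [inv_zero, HasValue, zero_sub, neg_mem_iff, algebraMap_mem_nonunits] at h
    exact hc h
  have hg : g ∈ P.ring := by
    by_contra hg
    exact hc (h.eq ((hasValue_inv_zero hg0).2 hg))
  have e : g - algebraMap ℂ F c⁻¹ = -algebraMap ℂ F c⁻¹ * g * (g⁻¹ - algebraMap ℂ F c) := by
    have : algebraMap ℂ F c ≠ 0 := by simpa using hc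
    rw [map_inv₀]
    field_simp
    ring
  rw [HasValue, e]
  exact mul_mem_nonunits (P.ring.mul_mem _ _ (neg_mem (P.algebraMap_mem _)) hg) h

theorem continuous_sphereValue (g : F) : Continuous fun P : Place F => P.sphereValue g :=
  continuous_iInf_dom continuous_induced_dom

theorem continuousAt_of_sphereValue {X : Type*} [TopologicalSpace X] {f : X → Place F} {x : X}
    (h : ∀ g : F, ContinuousAt (fun x => (f x).sphereValue g) x) : ContinuousAt f x := by
  rw [ContinuousAt, nhds_iInf, Filter.tendsto_iInf]
  intro g
  rw [nhds_induced, Filter.tendsto_comap_iff]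
  exact h g

/-- `ℂ` is open in the sphere, so near `P` the sphere value remains finite and agrees with `value`,
whose default `0` is not used there. -/
theorem continuousAt_value {g : F} {c : ℂ} (h : P.HasValue g c) :
    ContinuousAt (fun Q : Place F => Q.value g) P := by
  have hs := (continuous_sphereValue g).continuousAt (x := P)
  have hc : ∀ᶠ Q in nhds P, ∃ c : ℂ, Q.HasValue g c := by
    have : Set.range ((↑) : ℂ → OnePoint ℂ) ∈ nhds (P.sphereValue g) :=
      OnePoint.isOpen_range_coe.mem_nhds ⟨c, (sphereValue_eq_coe_iff.2 h).symm⟩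
    filter_upwards [hs this] with Q hQ
    obtain ⟨c, hc⟩ := hQ
    exact ⟨c, sphereValue_eq_coe_iff.1 hc.symm⟩
  rw [OnePoint.isOpenEmbedding_coe.isInducing.continuousAt_iff]
  refine hs.congr ?_
  filter_upwards [hc] with Q ⟨c, hc⟩
  rw [Function.comp_apply, hc.value_eq, sphereValue_eq_coe_iff.2 hc]

end Place

/-! ### Holomorphic functions on a disk and their field of fractions -/

/-- The algebra of holomorphic functions on the disk of radius `ε` centred at `0`. -/
def diskFunctions (ε : ℝ) : Subalgebra ℂ (Metric.ball (0 : ℂ) ε → ℂ) where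
  carrier := {f | ∃ F : ℂ → ℂ, DifferentiableOn ℂ F (Metric.ball 0 ε) ∧ ∀ z, f z = F z}
  mul_mem' := by
    rintro f g ⟨F, hF, hf⟩ ⟨G, hG, hg⟩
    exact ⟨F * G, hF.mul hG, fun z => by simp [hf, hg]⟩
  add_mem' := by
    rintro f g ⟨F, hF, hf⟩ ⟨G, hG, hg⟩
    exact ⟨F + G, hF.add hG, fun z => by simp [hf, hg]⟩
  algebraMap_mem' c := ⟨fun _ => c, differentiableOn_const c, fun _ => rfl⟩

/-- The ring of holomorphic functions on the disk of radius `ε` centred at `0`. -/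
def DiskRing (ε : ℝ) : Type := diskFunctions ε

instance (ε : ℝ) : CommRing (DiskRing ε) := inferInstanceAs (CommRing (diskFunctions ε))

instance (ε : ℝ) : Algebra ℂ (DiskRing ε) := inferInstanceAs (Algebra ℂ (diskFunctions ε))

namespace DiskRing

open Metric

variable {ε : ℝ}

/-- The restriction to the disk of a function holomorphic on it. -/
def ofFun (F : ℂ → ℂ) (hF : DifferentiableOn ℂ F (ball 0 ε)) : DiskRing ε :=
  ⟨fun z => F z, F, hF, fun _ => rfl⟩

@[simp]
theorem ofFun_apply (F : ℂ → ℂ) (hF : DifferentiableOn ℂ F (ball 0 ε)) (z : ball (0 : ℂ) ε) :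
    (ofFun F hF).1 z = F z := rfl

theorem exists_ofFun (f : DiskRing ε) : ∃ F hF, f = ofFun F hF := by
  obtain ⟨f, F, hF, hf⟩ := f
  exact ⟨F, hF, Subtype.ext (funext hf)⟩

/-- Evaluation at a point of the disk. -/
def evalAt (z : ball (0 : ℂ) ε) : DiskRing ε →ₐ[ℂ] ℂ where
  toFun f := f.1 z
  map_one' := rfl
  map_mul' _ _ := rfl
  map_zero' := rfl
  map_add' _ _ := rfl
  commutes' _ := rfl

theorem aeval_apply (f : DiskRing ε) (q : ℂ[X]) (z : ball (0 : ℂ) ε) :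
    (aeval f q).1 z = q.eval (f.1 z) := by
  change evalAt z (aeval f q) = _
  rw [← aeval_algHom_apply, ← coe_aeval_eq_eval]
  rfl

/-- The coordinate function of the disk. -/
def coord : DiskRing ε := ofFun (fun z => z) differentiableOn_id

instance : NoZeroDivisors (DiskRing ε) where
  eq_zero_or_eq_zero_of_mul_eq_zero {f g} h := by
    obtain ⟨F, hF, rfl⟩ := f.exists_ofFun
    obtain ⟨G, hG, rfl⟩ := g.exists_ofFun
    have h0 : ∀ z ∈ ball (0 : ℂ) ε, F z * G z = 0 := fun z hz =>
      congrFun (congrArg Subtype.val h) ⟨z, hz⟩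
    refine (AnalyticOnNhd.eq_zero_or_eq_zero_of_mul_eq_zero (hF.analyticOnNhd isOpen_ball)
      (hG.analyticOnNhd isOpen_ball) h0 (convex_ball 0 ε).isPreconnected).imp ?_ ?_ <;>
    exact fun h' => Subtype.ext (funext fun z => h' z z.2)

variable [hε : Fact (0 < ε)]

/-- The centre of the disk. -/
def center (ε : ℝ) [hε : Fact (0 < ε)] : ball (0 : ℂ) ε := ⟨0, mem_ball_self hε.out⟩

instance : Nontrivial (DiskRing ε) :=
  ⟨0, 1, fun h => zero_ne_one (congrFun (congrArg Subtype.val h) (center ε))⟩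

instance : IsDomain (DiskRing ε) := NoZeroDivisors.to_isDomain _

omit hε in
-- By the identity theorem `f` vanishes to finite order at `t`, and dividing by that power of the
-- coordinate leaves a removable singularity. This is what makes `regularAt t` a valuation ring.
theorem exists_eq_pow_mul (t : ball (0 : ℂ) ε) {f : DiskRing ε} (hf : f ≠ 0) :
    ∃ (k : ℕ) (g : DiskRing ε), g.1 t ≠ 0 ∧
      f = (coord - algebraMap ℂ (DiskRing ε) t) ^ k * g := by
  obtain ⟨F, hF, rfl⟩ := f.exists_ofFun
  have hFa := hF.analyticOnNhd isOpen_ball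
  have hne : ¬ ∀ᶠ z in nhds (t : ℂ), F z = 0 := fun h => hf <| Subtype.ext <| funext fun z =>
    hFa.eqOn_zero_of_preconnected_of_eventuallyEq_zero (convex_ball 0 ε).isPreconnected t.2 h z.2
  obtain ⟨k, g, hg, hgt, hFg⟩ := (hFa t t.2).exists_eventuallyEq_pow_smul_nonzero_iff.2 hne
  -- The local factor `g` exists only near `t`. The quotient is global, and `g t` fills its
  -- singularity.
  let G : ℂ → ℂ := Function.update (fun z => F z / (z - t) ^ k) t (g t)
  have hGt : G t = g t := Function.update_self _ _ _
  have hGz : ∀ z : ℂ, z ≠ t → G z = F z / (z - t) ^ k := fun z hz => Function.update_of_ne hz _ _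
  have hG : DifferentiableOn ℂ G (ball 0 ε) := by
    intro z hz
    apply DifferentiableAt.differentiableWithinAt
    rcases eq_or_ne z (t : ℂ) with rfl | hzt
    · refine hg.differentiableAt.congr_of_eventuallyEq ?_
      filter_upwards [hFg] with w hw
      rcases eq_or_ne w (t : ℂ) with rfl | hwt
      · exact hGt
      · rw [hGz w hwt, hw, smul_eq_mul, mul_div_cancel_left₀ _ (pow_ne_zero _ (sub_ne_zero.2 hwt))]
    · have : DifferentiableAt ℂ (fun z => F z / (z - t) ^ k) z :=
        ((hFa z hz).differentiableAt).div (by fun_prop) (pow_ne_zero _ (sub_ne_zero.2 hzt))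
      refine this.congr_of_eventuallyEq ?_
      filter_upwards [isOpen_ne.mem_nhds hzt] with w hw
      exact hGz w hw
  refine ⟨k, ofFun G hG, by rwa [ofFun_apply, hGt], Subtype.ext (funext fun z => ?_)⟩
  change F z = ((z : ℂ) - t) ^ k * G z
  rcases eq_or_ne (z : ℂ) (t : ℂ) with hz | hz
  · rw [hz, hGt, hFg.self_of_nhds, smul_eq_mul]
  · rw [hGz z hz, mul_div_cancel₀ _ (pow_ne_zero _ (sub_ne_zero.2 hz))]

/-- The field of fractions of the ring of holomorphic functions on the disk. -/
def Frac (ε : ℝ) [Fact (0 < ε)] : Type := FractionRing (DiskRing ε)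

instance : Field (Frac ε) := inferInstanceAs (Field (FractionRing (DiskRing ε)))

instance : Algebra (DiskRing ε) (Frac ε) :=
  inferInstanceAs (Algebra (DiskRing ε) (FractionRing (DiskRing ε)))

instance : IsFractionRing (DiskRing ε) (Frac ε) :=
  inferInstanceAs (IsFractionRing (DiskRing ε) (FractionRing (DiskRing ε)))

instance : Algebra ℂ (Frac ε) := inferInstanceAs (Algebra ℂ (FractionRing (DiskRing ε)))

instance : IsScalarTower ℂ (DiskRing ε) (Frac ε) :=
  inferInstanceAs (IsScalarTower ℂ (DiskRing ε) (FractionRing (DiskRing ε)))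

theorem algebraMap_ne_zero {d : DiskRing ε} {t : ball (0 : ℂ) ε} (hd : d.1 t ≠ 0) :
    algebraMap (DiskRing ε) (Frac ε) d ≠ 0 := by
  rw [Ne, IsFractionRing.to_map_eq_zero_iff]
  rintro rfl
  exact hd rfl

/-- The valuation ring of the quotients of holomorphic functions that are regular at `t`. -/
def regularAt (t : ball (0 : ℂ) ε) : ValuationSubring (Frac ε) where
  carrier := {x | ∃ n d : DiskRing ε, d.1 t ≠ 0 ∧
    x * algebraMap (DiskRing ε) (Frac ε) d = algebraMap (DiskRing ε) (Frac ε) n}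
  mul_mem' := by
    rintro x y ⟨n, d, hd, h⟩ ⟨n', d', hd', h'⟩
    refine ⟨n * n', d * d', mul_ne_zero hd hd', ?_⟩
    rw [map_mul, map_mul, ← h, ← h']; ring
  one_mem' := ⟨1, 1, one_ne_zero, by simp⟩
  add_mem' := by
    rintro x y ⟨n, d, hd, h⟩ ⟨n', d', hd', h'⟩
    refine ⟨n * d' + n' * d, d * d', mul_ne_zero hd hd', ?_⟩
    rw [map_add, map_mul, map_mul, map_mul, ← h, ← h']; ring
  zero_mem' := ⟨0, 1, one_ne_zero, by simp⟩
  neg_mem' := by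
    rintro x ⟨n, d, hd, h⟩
    exact ⟨-n, d, hd, by rw [map_neg, ← h, neg_mul]⟩
  mem_or_inv_mem' := by
    intro x
    obtain ⟨n, d, hd, rfl⟩ := IsFractionRing.div_surjective (A := DiskRing ε) x
    rcases eq_or_ne n 0 with rfl | hn
    · exact Or.inl ⟨0, 1, one_ne_zero, by simp⟩
    obtain ⟨k, n', hn', rfl⟩ := exists_eq_pow_mul t hn
    obtain ⟨l, d', hd', rfl⟩ := exists_eq_pow_mul t (nonZeroDivisors.ne_zero hd)
    have hπ : algebraMap (DiskRing ε) (Frac ε) (coord - algebraMap ℂ (DiskRing ε) t) ≠ 0 ∨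
        (k = 0 ∧ l = 0) := by
      rw [Ne, IsFractionRing.to_map_eq_zero_iff]
      rcases eq_or_ne k 0 with rfl | hk
      · rcases eq_or_ne l 0 with rfl | hl
        · exact Or.inr ⟨rfl, rfl⟩
        · refine Or.inl fun h => nonZeroDivisors.ne_zero hd ?_
          rw [h, zero_pow hl, zero_mul]
      · refine Or.inl fun h => hn ?_
        rw [h, zero_pow hk, zero_mul]
    have aux : ∀ {K : Type} [Field K] {p q n d : K}, p ≠ 0 → d ≠ 0 →
        p * q * n / (p * d) * d = q * n := by
      intros
      field_simp
    have hn0 := algebraMap_ne_zero hn'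
    have hd0 := algebraMap_ne_zero hd'
    rcases hπ with hπ | ⟨rfl, rfl⟩
    · rcases le_total l k with hlk | hlk
      · obtain ⟨j, rfl⟩ := Nat.exists_eq_add_of_le hlk
        refine Or.inl ⟨(coord - algebraMap ℂ (DiskRing ε) t) ^ j * n', d', hd', ?_⟩
        simp only [map_mul, map_pow, pow_add]
        exact aux (pow_ne_zero _ hπ) hd0
      · obtain ⟨j, rfl⟩ := Nat.exists_eq_add_of_le hlk
        refine Or.inr ⟨(coord - algebraMap ℂ (DiskRing ε) t) ^ j * d', n', hn', ?_⟩
        simp only [map_mul, map_pow, pow_add, inv_div]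
        exact aux (pow_ne_zero _ hπ) hn0
    · refine Or.inl ⟨n', d', hd', ?_⟩
      simp only [pow_zero, one_mul]
      exact div_mul_cancel₀ _ hd0

theorem mem_nonunits_regularAt {t : ball (0 : ℂ) ε} {x : Frac ε} : x ∈ (regularAt t).nonunits ↔
    ∃ n d : DiskRing ε, n.1 t = 0 ∧ d.1 t ≠ 0 ∧
      x * algebraMap (DiskRing ε) (Frac ε) d = algebraMap (DiskRing ε) (Frac ε) n := by
  constructor
  · intro h
    obtain ⟨n, d, hd, hx⟩ := (regularAt t).nonunits_subset h
    refine ⟨n, d, by_contra fun hn => ?_, hd, hx⟩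
    rcases (ValuationSubring.mem_nonunits_iff_or _).1 h with rfl | h'
    · rw [zero_mul] at hx
      exact algebraMap_ne_zero hn hx.symm
    · refine h' ⟨d, n, hn, ?_⟩
      have hx0 : x ≠ 0 := by
        rintro rfl
        rw [zero_mul] at hx
        exact algebraMap_ne_zero hn hx.symm
      rw [← hx, inv_mul_cancel_left₀ hx0]
  · rintro ⟨n, d, hn, hd, hx⟩
    rw [ValuationSubring.mem_nonunits_iff_or, or_iff_not_imp_left]
    rintro hx0 ⟨n', d', hd', hx'⟩
    have : n' * n = d' * d := by
      apply IsFractionRing.injective (DiskRing ε) (Frac ε)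
      rw [map_mul, map_mul, ← hx, ← hx']
      field_simp
    have := congrFun (congrArg Subtype.val this) t
    change n'.1 t * n.1 t = d'.1 t * d.1 t at this
    rw [hn, mul_zero] at this
    exact mul_ne_zero hd' hd this.symm

section Rotation

variable {c : ℂ} (hc : ‖c‖ = 1)

omit hε in
include hc in
theorem mul_mem_ball {z : ℂ} (hz : z ∈ ball (0 : ℂ) ε) : c * z ∈ ball (0 : ℂ) ε := by
  rw [mem_ball_zero_iff] at hz ⊢
  rwa [norm_mul, hc, one_mul]

/-- The rotation `t ↦ c * t` of the disk. -/
def rotate (t : ball (0 : ℂ) ε) : ball (0 : ℂ) ε := ⟨c * t, mul_mem_ball hc t.2⟩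

/-- Precomposition with the rotation `t ↦ c * t`. -/
def precompRotate : DiskRing ε →ₐ[ℂ] DiskRing ε where
  toFun f := ⟨fun z => f.1 (rotate hc z), by
    obtain ⟨F, hF, hf⟩ := f.2
    refine ⟨fun z => F (c * z), hF.comp (by fun_prop) fun z hz => mul_mem_ball hc hz,
      fun z => hf (rotate hc z)⟩⟩
  map_one' := rfl
  map_mul' _ _ := rfl
  map_zero' := rfl
  map_add' _ _ := rfl
  commutes' _ := rfl

omit hε in
theorem precompRotate_injective : Function.Injective (precompRotate (ε := ε) hc) := by
  intro f g h
  refine Subtype.ext (funext fun z => ?_)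
  have hc0 : c ≠ 0 := by
    rintro rfl
    simp at hc
  have hc' : ‖c⁻¹‖ = 1 := by rw [norm_inv, hc, inv_one]
  have hz : rotate hc (rotate hc' z) = z := Subtype.ext (mul_inv_cancel_left₀ hc0 _)
  have := congrFun (congrArg Subtype.val h) (rotate hc' z)
  change f.1 (rotate hc (rotate hc' z)) = g.1 (rotate hc (rotate hc' z)) at this
  rwa [hz] at this

/-- The endomorphism of the field of fractions induced by the rotation `t ↦ c * t`. -/
def fracRotate : Frac ε →+* Frac ε :=
  IsFractionRing.map (j := (precompRotate (ε := ε) hc).toRingHom) (precompRotate_injective hc)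

theorem fracRotate_algebraMap (f : DiskRing ε) :
    fracRotate hc (algebraMap (DiskRing ε) (Frac ε) f) =
      algebraMap (DiskRing ε) (Frac ε) (precompRotate hc f) :=
  IsLocalization.map_eq (nonZeroDivisors_le_comap_nonZeroDivisors_of_injective
    (precompRotate (ε := ε) hc).toRingHom (precompRotate_injective hc)) f

/-- Rotating numerator and denominator transports regularity at `c * t` to `t`. For the other
direction, if `x` is not regular at `c * t` then `x⁻¹` vanishes there, and rotating it shows that
the image of `x` has a pole at `t`. -/
theorem fracRotate_mem_regularAt {t : ball (0 : ℂ) ε} {x : Frac ε} :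
    fracRotate hc x ∈ regularAt t ↔ x ∈ regularAt (rotate hc t) := by
  constructor
  · intro h
    by_contra hx
    obtain ⟨n, d, hn, hd, hnd⟩ := mem_nonunits_regularAt.1
      ((ValuationSubring.inv_mem_nonunits_iff _).2 (Or.inr hx))
    have h' : (fracRotate hc x)⁻¹ ∈ (regularAt t).nonunits := by
      refine mem_nonunits_regularAt.2 ⟨precompRotate hc n, precompRotate hc d, hn, hd, ?_⟩
      rw [← fracRotate_algebraMap, ← fracRotate_algebraMap, ← hnd, map_mul, map_inv₀]
    rcases (ValuationSubring.inv_mem_nonunits_iff _).1 h' with h0 | h0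
    · rw [map_eq_zero] at h0
      exact hx (h0 ▸ zero_mem _)
    · exact h0 h
  · rintro ⟨n, d, hd, hnd⟩
    refine ⟨precompRotate hc n, precompRotate hc d, hd, ?_⟩
    rw [← fracRotate_algebraMap, ← fracRotate_algebraMap, ← hnd, map_mul]

end Rotation

end DiskRing

/-! ### Holomorphic families of places parametrized by a disk -/

namespace Place

open Metric DiskRing

variable {F : Type*} [Field F] [Algebra ℂ F] {ε : ℝ} [hε : Fact (0 < ε)] (ι : F →ₐ[ℂ] Frac ε)

/-- The place of `F` obtained by evaluation at a point `t` of the disk, for a homomorphism of `F`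
to the quotients of holomorphic functions on the disk. -/
def ofDisk (hι : ∀ t : ball (0 : ℂ) ε, ∃ g : F, ι g ∉ regularAt t) (t : ball (0 : ℂ) ε) :
    Place F where
  ring := (regularAt t).comap (ι : F →+* Frac ε)
  algebraMap_mem c := by
    rw [ValuationSubring.mem_comap]
    change ι (algebraMap ℂ F c) ∈ regularAt t
    refine ⟨algebraMap ℂ _ c, 1, one_ne_zero, ?_⟩
    rw [ι.commutes, map_one, mul_one, IsScalarTower.algebraMap_apply ℂ (DiskRing ε) (Frac ε)]
  ne_top h := by
    obtain ⟨g, hg⟩ := hι t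
    exact hg ((ValuationSubring.mem_comap (f := (ι : F →+* Frac ε))).1 (h ▸ trivial))

variable {ι} (hι : ∀ t : ball (0 : ℂ) ε, ∃ g : F, ι g ∉ regularAt t)

theorem mem_ofDisk {t : ball (0 : ℂ) ε} {g : F} : g ∈ (ofDisk ι hι t).ring ↔ ι g ∈ regularAt t :=
  Iff.rfl

theorem hasValue_ofDisk {t : ball (0 : ℂ) ε} {g : F} {n d : DiskRing ε} (hd : d.1 t ≠ 0)
    (h : ι g * algebraMap (DiskRing ε) (Frac ε) d = algebraMap (DiskRing ε) (Frac ε) n) :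
    (ofDisk ι hι t).HasValue g (n.1 t / d.1 t) := by
  have e : ∀ a : F, a ∈ (ofDisk ι hι t).ring.nonunits ↔ ι a ∈ (regularAt t).nonunits := by
    intro a
    rw [ValuationSubring.mem_nonunits_iff_or, ValuationSubring.mem_nonunits_iff_or, mem_ofDisk,
      map_inv₀, map_eq_zero]
  rw [HasValue, e, mem_nonunits_regularAt]
  refine ⟨n - algebraMap ℂ _ (n.1 t / d.1 t) * d, d, ?_, hd, ?_⟩
  · change n.1 t - n.1 t / d.1 t * d.1 t = 0
    rw [div_mul_cancel₀ _ hd, sub_self]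
  · rw [map_sub, map_sub, map_mul, sub_mul, h, ι.commutes,
      IsScalarTower.algebraMap_apply ℂ (DiskRing ε) (Frac ε)]

theorem map_ofDisk {c : ℂ} (hc : ‖c‖ = 1) {τ : F ≃ₐ[ℂ] F}
    (h : ∀ g, ι (τ g) = fracRotate hc (ι g)) (t : ball (0 : ℂ) ε) :
    map τ (ofDisk ι hι t) = ofDisk ι hι (rotate hc t) := by
  apply ext_ring
  ext g
  rw [mem_ofDisk, ← fracRotate_mem_regularAt, ← h]
  rfl

open Classical in
/-- The family `t ↦ ofDisk ι hι t`, extended to a function on `ℂ`. -/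
def diskParam (w : ℂ) : Place F :=
  -- Outside the disk the centre is a default value. Only points of the disk matter below.
  if hw : w ∈ ball (0 : ℂ) ε then ofDisk ι hι ⟨w, hw⟩ else ofDisk ι hι (center ε)

theorem diskParam_of_mem {w : ℂ} (hw : w ∈ ball (0 : ℂ) ε) :
    diskParam hι w = ofDisk ι hι ⟨w, hw⟩ := dif_pos hw

theorem exists_hasValue_diskParam {w : ℂ} (hw : w ∈ ball (0 : ℂ) ε) {g : F}
    (hg : g ∈ (diskParam hι w).ring) : ∃ f : ℂ → ℂ, AnalyticAt ℂ f w ∧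
      ∀ᶠ z in nhds w, (diskParam hι z).HasValue g (f z) := by
  rw [diskParam_of_mem hι hw, mem_ofDisk] at hg
  obtain ⟨n, d, hd, h⟩ := hg
  obtain ⟨N, hN, rfl⟩ := n.exists_ofFun
  obtain ⟨D, hD, rfl⟩ := d.exists_ofFun
  have hDa := hD.analyticOnNhd isOpen_ball w hw
  refine ⟨fun z => N z / D z, (hN.analyticOnNhd isOpen_ball w hw).div hDa hd, ?_⟩
  filter_upwards [isOpen_ball.mem_nhds hw, hDa.continuousAt.eventually_ne hd] with z hz hDz
  rw [diskParam_of_mem hι hz]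
  exact hasValue_ofDisk hι (t := ⟨z, hz⟩) hDz h

theorem analyticAt_value_diskParam {w : ℂ} (hw : w ∈ ball (0 : ℂ) ε) {g : F}
    (hg : g ∈ (diskParam hι w).ring) : AnalyticAt ℂ (fun z => (diskParam hι z).value g) w := by
  obtain ⟨f, hf, h⟩ := exists_hasValue_diskParam hι hw hg
  refine hf.congr ?_
  filter_upwards [h] with z hz
  exact hz.value_eq.symm

theorem continuousAt_diskParam {w : ℂ} (hw : w ∈ ball (0 : ℂ) ε) :
    ContinuousAt (diskParam hι) w := by
  refine continuousAt_of_sphereValue fun g => ?_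
  by_cases hg : g ∈ (diskParam hι w).ring
  · obtain ⟨f, hf, h⟩ := exists_hasValue_diskParam hι hw hg
    refine ContinuousAt.congr (f := fun z => (f z : OnePoint ℂ))
      (OnePoint.continuous_coe.continuousAt.comp hf.continuousAt) ?_
    filter_upwards [h] with z hz
    exact (sphereValue_eq_coe_iff.2 hz).symm
  -- At a pole of `g`, the inverse is regular with value `0`. Its values near `w` tend to `0`, so
  -- those of `g` leave every compact set or are `∞`.
  · have hg0 : g ≠ 0 := by
      rintro rfl
      exact hg (zero_mem _)
    have hgi : (diskParam hι w).HasValue g⁻¹ 0 := (hasValue_inv_zero hg0).2 hg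
    obtain ⟨f, hf, h⟩ := exists_hasValue_diskParam hι hw hgi.mem
    have hf0 : Filter.Tendsto f (nhds w) (nhds 0) := by
      have := hf.continuousAt.tendsto
      rwa [h.self_of_nhds.eq hgi] at this
    rw [ContinuousAt, sphereValue_eq_infty hg, Filter.Tendsto, OnePoint.le_nhds_infty]
    intro s _ hs
    have hev : ∀ᶠ y in nhds (0 : ℂ), y ≠ 0 → y⁻¹ ∈ sᶜ := eventually_nhdsWithin_iff.1 <|
      Filter.tendsto_inv₀_nhdsNE_zero.eventually
        (Metric.cobounded_eq_cocompact (α := ℂ) ▸ hs.compl_mem_cocompact)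
    rw [Filter.mem_map]
    filter_upwards [h, hf0.eventually hev] with z hz hzs
    by_cases hfz : f z = 0
    · rw [hfz, hasValue_inv_zero hg0] at hz
      exact Or.inr (sphereValue_eq_infty hz)
    · exact Or.inl ⟨_, hzs hfz, (sphereValue_eq_coe_iff.2 (hz.of_inv hfz)).symm⟩

end Place

/-! ### Holomorphic roots, and uniqueness of the multiplier at a fixed point -/

theorem AnalyticAt.exists_pow_eq {f : ℂ → ℂ} {z₀ : ℂ} (hf : AnalyticAt ℂ f z₀) (h0 : f z₀ ≠ 0)
    {n : ℕ} (hn : n ≠ 0) : ∃ g : ℂ → ℂ, AnalyticAt ℂ g z₀ ∧ ∀ᶠ z in nhds z₀, g z ^ n = f z := by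
  obtain ⟨c, hc⟩ := IsAlgClosed.exists_pow_nat_eq (f z₀) (Nat.pos_of_ne_zero hn)
  -- Dividing by `f z₀` moves the value at `z₀` to `1`, away from the cut of the principal branch.
  -- The constant `c` restores the factor.
  refine ⟨fun z => c * (f z / f z₀) ^ (1 / (n : ℂ)), ?_, Filter.Eventually.of_forall fun z => ?_⟩
  · refine analyticAt_const.mul ((hf.div analyticAt_const h0).cpow analyticAt_const ?_)
    change f z₀ / f z₀ ∈ _
    rw [div_self h0]
    exact Complex.one_mem_slitPlane
  · rw [mul_pow, hc, one_div, Complex.cpow_nat_inv_pow _ hn, mul_div_cancel₀ _ h0]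

/-- A holomorphic function that is injective near a point has nonzero derivative there. -/
theorem AnalyticAt.deriv_ne_zero_of_injOn {f : ℂ → ℂ} {z₀ : ℂ} (hf : AnalyticAt ℂ f z₀)
    {s : Set ℂ} (hs : s ∈ nhds z₀) (hinj : Set.InjOn f s) : deriv f z₀ ≠ 0 := by
  have hsub : AnalyticAt ℂ (fun z => f z - f z₀) z₀ := hf.sub analyticAt_const
  have hne : ¬ ∀ᶠ z in nhds z₀, f z - f z₀ = 0 := by
    intro h
    obtain ⟨z, ⟨hz, hzs⟩, hzne⟩ :=
      ((h.and hs).filter_mono nhdsWithin_le_nhds |>.and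
        (self_mem_nhdsWithin (s := {z₀}ᶜ) (a := z₀))).exists
    exact hzne (hinj hzs (mem_of_mem_nhds hs) (sub_eq_zero.1 hz))
  obtain ⟨n, k, hk, hk0, hfk⟩ := hsub.exists_eventuallyEq_pow_smul_nonzero_iff.2 hne
  have hn : n ≠ 0 := by
    rintro rfl
    have := hfk.self_of_nhds
    simp only [sub_self, pow_zero, one_smul] at this
    exact hk0 this.symm
  obtain ⟨K, hK, hKk⟩ := hk.exists_pow_eq hk0 hn
  have hK0 : K z₀ ≠ 0 := by
    intro h
    have := hKk.self_of_nhds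
    rw [h, zero_pow hn] at this
    exact hk0 this.symm
  -- Here `f = f z₀ + S ^ n` near `z₀`, with `S` locally invertible because `S' z₀ = K z₀ ≠ 0`.
  let S : ℂ → ℂ := fun z => (z - z₀) * K z
  have hS : AnalyticAt ℂ S z₀ := (analyticAt_id.sub analyticAt_const).mul hK
  have hS' : HasDerivAt S (K z₀) z₀ := by
    have := ((hasDerivAt_id z₀).sub_const z₀).mul hK.differentiableAt.hasDerivAt
    simp only [id, sub_self, zero_mul, one_mul, add_zero] at this
    exact this
  have hfS : ∀ᶠ z in nhds z₀, f z = f z₀ + S z ^ n := by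
    filter_upwards [hfk, hKk] with z h1 h2
    rw [mul_pow, h2, ← smul_eq_mul, ← h1, add_sub_cancel]
  have hS0 : S z₀ = 0 := by simp [S]
  have hstrict : HasStrictDerivAt S (K z₀) z₀ := hS'.deriv ▸ hS.hasStrictDerivAt
  have hmap := hstrict.map_nhds_eq hK0
  rw [hS0] at hmap
  obtain rfl | hn1 := eq_or_ne n 1
  · have : HasDerivAt f (K z₀) z₀ := by
      refine (hS'.const_add (f z₀)).congr_of_eventuallyEq ?_
      filter_upwards [hfS] with z hz
      rw [hz, pow_one]
    rwa [this.deriv]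
  -- For `n > 1` and `ω` a primitive `n`-th root of unity, some `z, w` near `z₀` satisfy `S w = ω *
  -- S z ≠ 0`. Then `f z = f w`, so injectivity gives `z = w` and `ω = 1`.
  · exfalso
    have hprim := Complex.isPrimitiveRoot_exp n hn
    set ω := Complex.exp (2 * Real.pi * Complex.I / n)
    have himg : S '' (s ∩ {z | f z = f z₀ + S z ^ n}) ∈ nhds (0 : ℂ) := by
      rw [← hmap]
      exact Filter.image_mem_map (Filter.inter_mem hs hfS)
    have himg' : ∀ᶠ y in nhds (0 : ℂ), ω * y ∈ S '' (s ∩ {z | f z = f z₀ + S z ^ n}) := by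
      have : Filter.Tendsto (fun y : ℂ => ω * y) (nhds 0) (nhds 0) := by
        simpa using (continuous_const_mul ω).tendsto 0
      exact this himg
    obtain ⟨y, ⟨⟨z, ⟨hz, hz'⟩, rfl⟩, w, ⟨hw, hw'⟩, hwz⟩, hy0⟩ :=
      ((Filter.Eventually.and himg himg').filter_mono nhdsWithin_le_nhds |>.and
        (self_mem_nhdsWithin (s := {(0 : ℂ)}ᶜ) (a := 0))).exists
    have hfeq : f z = f w := by
      rw [Set.mem_ofPred_eq] at hz' hw'
      rw [hz', hw', hwz, mul_pow ω, hprim.pow_eq_one, one_mul]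
    rw [← hinj hz hw hfeq] at hwz
    have h1 : ω = 1 := (mul_eq_right₀ hy0).1 hwz.symm
    exact hprim.ne_one (by omega) h1

/-- If a holomorphic function that is injective near `0` turns multiplication by `c` into
multiplication by `c'`, then `c = c'`. -/
theorem eq_of_conj_mul {T : ℂ → ℂ} (hT : AnalyticAt ℂ T 0) {s : Set ℂ} (hs : s ∈ nhds 0)
    (hinj : Set.InjOn T s) {c c' : ℂ} (h : ∀ᶠ w in nhds 0, T (c * w) = c' * T w) : c = c' := by
  have hT' := hT.differentiableAt.hasDerivAt
  have h1 : HasDerivAt (fun w => T (c * w)) (deriv T 0 * c) 0 := by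
    refine HasDerivAt.comp (h₂ := T) (h := fun w => c * w) 0 ?_ ?_
    · rwa [mul_zero]
    · simpa using (hasDerivAt_id (0 : ℂ)).const_mul c
  have h2 := (hT'.const_mul c').unique (h1.congr_of_eventuallyEq (h.mono fun _ hw => hw.symm))
  rw [mul_comm] at h2
  exact (mul_left_cancel₀ (hT.deriv_ne_zero_of_injOn hs hinj) h2).symm

/-! ### The local parametrization of the curve above `x_i` -/

namespace SuperellipticDatum

variable {p : ℕ} (S : SuperellipticDatum p) (i : Fin S.r)

/-- The factor of the right-hand side that does not vanish at `x_i`. -/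
def cofactor : ℂ[X] := ∏ j ∈ Finset.univ.erase i, (X - C (S.pt j)) ^ S.v j

theorem rhsPoly_eq : S.rhsPoly = (X - C (S.pt i)) ^ S.v i * S.cofactor i :=
  (Finset.mul_prod_erase _ _ (Finset.mem_univ i)).symm

theorem eval_cofactor_ne_zero : (S.cofactor i).eval (S.pt i) ≠ 0 := by
  rw [cofactor, eval_prod, Finset.prod_ne_zero_iff]
  intro j hj
  rw [eval_pow, eval_sub, eval_X, eval_C]
  exact pow_ne_zero _ (sub_ne_zero.2 fun h => (Finset.mem_erase.1 hj).1 (S.pt_injective h).symm)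

/-- The natural number `a < p` with `a * v_i ≡ 1` modulo `p`. -/
def invExp : ℕ := ((S.v i : ZMod p)⁻¹).val

/-- The natural number `k` with `a * v_i = 1 + p * k`, for `a = S.invExp i`. -/
def quoExp : ℕ := S.invExp i * S.v i / p

variable [hp : Fact p.Prime]

theorem v_ne_zero : (S.v i : ZMod p) ≠ 0 := by
  rw [Ne, ZMod.natCast_eq_zero_iff]
  exact Nat.not_dvd_of_pos_of_lt (S.v_pos i) (S.v_lt i)

theorem invExp_mul_v : S.invExp i * S.v i = 1 + p * S.quoExp i := by
  have h : S.invExp i * S.v i % p = 1 := by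
    rw [← Nat.mod_eq_of_lt hp.out.one_lt]
    refine (ZMod.natCast_eq_natCast_iff' _ _ p).1 ?_
    rw [Nat.cast_mul, invExp, ZMod.natCast_val, ZMod.cast_id, inv_mul_cancel₀ (S.v_ne_zero i),
      Nat.cast_one]
  rw [quoExp, add_comm, ← h]
  exact (Nat.div_add_mod _ _).symm

/-- A holomorphic `p`-th root of the cofactor on a disk around `x_i`; the radius is that of the
corresponding disk in a local coordinate whose `p`-th power is `x - x_i`. -/
structure LocalBranch where
  radius : ℝ
  radius_pos : 0 < radius
  root : ℂ → ℂ
  differentiableOn_root : DifferentiableOn ℂ root (Metric.ball 0 (radius ^ p))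
  root_pow : ∀ s ∈ Metric.ball (0 : ℂ) (radius ^ p),
    root s ^ p = (S.cofactor i).eval (S.pt i + s)
  root_ne_zero : ∀ s ∈ Metric.ball (0 : ℂ) (radius ^ p), root s ≠ 0

theorem nonempty_localBranch : Nonempty (S.LocalBranch i) := by
  have hf : AnalyticAt ℂ (fun s => (S.cofactor i).eval (S.pt i + s)) 0 := by
    refine Differentiable.analyticAt (f := fun s => (S.cofactor i).eval (S.pt i + s)) ?_ 0
    exact (S.cofactor i).differentiable.comp (by fun_prop)
  have h0 : (S.cofactor i).eval (S.pt i + 0) ≠ 0 := by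
    rw [add_zero]
    exact S.eval_cofactor_ne_zero i
  obtain ⟨H, hH, hHp⟩ := hf.exists_pow_eq h0 hp.out.ne_zero
  have hH0 : H 0 ≠ 0 := by
    intro h
    have := hHp.self_of_nhds
    rw [h, zero_pow hp.out.ne_zero] at this
    exact h0 this.symm
  have hev := (hH.eventually_analyticAt.and hHp).and (hH.continuousAt.eventually_ne hH0)
  obtain ⟨δ, hδ, hball⟩ := Metric.eventually_nhds_iff_ball.1 hev
  -- The branch lives on the disk of radius `radius ^ p`. Capping the radius at `1` keeps that power
  -- at most `δ`.
  have hle : min δ 1 ^ p ≤ δ :=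
    (pow_le_of_le_one (le_min hδ.le zero_le_one) (min_le_right _ _) hp.out.ne_zero).trans
      (min_le_left _ _)
  exact ⟨⟨min δ 1, lt_min hδ one_pos, H,
    fun s hs => (hball s (Metric.ball_subset_ball hle hs)).1.1.differentiableAt
      |>.differentiableWithinAt,
    fun s hs => (hball s (Metric.ball_subset_ball hle hs)).1.2,
    fun s hs => (hball s (Metric.ball_subset_ball hle hs)).2⟩⟩

namespace LocalBranch

open Metric DiskRing Place

variable {S i} (D : S.LocalBranch i)

instance : Fact (0 < D.radius) := ⟨D.radius_pos⟩

theorem pow_mem_ball_iff {t : ℂ} :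
    t ^ p ∈ ball (0 : ℂ) (D.radius ^ p) ↔ t ∈ ball (0 : ℂ) D.radius := by
  rw [mem_ball_zero_iff, mem_ball_zero_iff, norm_pow]
  exact pow_lt_pow_iff_left₀ (norm_nonneg _) D.radius_pos.le hp.out.ne_zero

theorem differentiableOn_root_pow :
    DifferentiableOn ℂ (fun t => D.root (t ^ p)) (ball 0 D.radius) :=
  D.differentiableOn_root.comp (by fun_prop) fun _ ht => D.pow_mem_ball_iff.2 ht

/-- The function `x` in terms of the local coordinate. -/
def xFun : DiskRing D.radius := ofFun (fun t => S.pt i + t ^ p) (by fun_prop)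

/-- The function `y` in terms of the local coordinate. -/
def yFun : DiskRing D.radius :=
  ofFun (fun t => t ^ S.v i * D.root (t ^ p)) (.mul (by fun_prop) D.differentiableOn_root_pow)

/-- At `x = x_i + t ^ p` the factor `(x - x_i) ^ v_i` becomes `(t ^ v_i) ^ p`, and `root` supplies
the `p`-th root of the cofactor. -/
theorem yFun_pow : D.yFun ^ p = aeval D.xFun S.rhsPoly := by
  refine Subtype.ext (funext fun t => ?_)
  rw [aeval_apply]
  change ((t : ℂ) ^ S.v i * D.root ((t : ℂ) ^ p)) ^ p = S.rhsPoly.eval (S.pt i + (t : ℂ) ^ p)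
  rw [mul_pow, D.root_pow _ (D.pow_mem_ball_iff.2 t.2), S.rhsPoly_eq i, eval_mul, eval_pow,
    eval_sub, eval_X, eval_C, add_sub_cancel_left, ← pow_mul, ← pow_mul, mul_comm p]

/-- The function `x_i + t ^ p` takes every value near `x_i`, so a polynomial in the kernel has
infinitely many roots. -/
theorem aeval_xFun_injective : Function.Injective (aeval (R := ℂ) D.xFun) := by
  rw [injective_iff_map_eq_zero]
  intro q hq
  refine q.eq_zero_of_infinite_isRoot (infinite_of_mem_nhds (S.pt i) ?_)
  refine Filter.mem_of_superset (ball_mem_nhds (S.pt i) (pow_pos D.radius_pos p)) fun w hw => ?_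
  obtain ⟨t, ht⟩ := IsAlgClosed.exists_pow_nat_eq (w - S.pt i) hp.out.pos
  have htb : t ∈ ball (0 : ℂ) D.radius := by
    rwa [← D.pow_mem_ball_iff, ht, mem_ball_zero_iff, ← mem_ball_iff_norm]
  have := D.xFun.aeval_apply q ⟨t, htb⟩
  rw [hq] at this
  change 0 = q.eval (S.pt i + t ^ p) at this
  rw [ht, add_sub_cancel] at this
  exact this.symm

/-- The embedding of `ℂ(x)` in the quotients of holomorphic functions of the local coordinate. -/
def liftRat : RatFunc ℂ →ₐ[ℂ] Frac D.radius :=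
  RatFunc.liftAlgHom ((IsScalarTower.toAlgHom ℂ (DiskRing D.radius) (Frac D.radius)).comp
      (aeval D.xFun))
    (nonZeroDivisors_le_comap_nonZeroDivisors_of_injective _
      ((IsFractionRing.injective (DiskRing D.radius) (Frac D.radius)).comp D.aeval_xFun_injective))

theorem liftRat_algebraMap (q : ℂ[X]) : D.liftRat (algebraMap ℂ[X] (RatFunc ℂ) q) =
    algebraMap (DiskRing D.radius) (Frac D.radius) (aeval D.xFun q) := by
  have := RatFunc.liftAlgHom_apply_div (S := ℂ)
    ((IsScalarTower.toAlgHom ℂ (DiskRing D.radius) (Frac D.radius)).comp (aeval D.xFun))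
    (nonZeroDivisors_le_comap_nonZeroDivisors_of_injective _
      ((IsFractionRing.injective (DiskRing D.radius) (Frac D.radius)).comp D.aeval_xFun_injective))
    q 1
  rwa [map_one, div_one, map_one, div_one] at this

/-- The embedding of `Ω_f` in the quotients of holomorphic functions of the local coordinate. -/
def embed : S.FunctionField →ₐ[ℂ] Frac D.radius :=
  AdjoinRoot.liftAlgHom S.eqn D.liftRat (algebraMap (DiskRing D.radius) (Frac D.radius) D.yFun)
    <| by
    simp only [eqn, eval₂_sub, eval₂_pow, eval₂_X, eval₂_C, rhs]
    rw [← map_pow, D.yFun_pow, sub_eq_zero]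
    exact (D.liftRat_algebraMap _).symm

theorem embed_algebraMap (g : RatFunc ℂ) :
    D.embed (algebraMap (RatFunc ℂ) S.FunctionField g) = D.liftRat g :=
  AdjoinRoot.liftAlgHom_of ..

theorem embed_algebraMap_poly (q : ℂ[X]) :
    D.embed (algebraMap (RatFunc ℂ) S.FunctionField (algebraMap ℂ[X] (RatFunc ℂ) q)) =
      algebraMap (DiskRing D.radius) (Frac D.radius) (aeval D.xFun q) := by
  rw [embed_algebraMap, liftRat_algebraMap]

theorem embed_y : D.embed S.y = algebraMap (DiskRing D.radius) (Frac D.radius) D.yFun :=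
  AdjoinRoot.liftAlgHom_root ..

/-- The function `1 / (x - x(t))` has a pole at `t`, so evaluation at `t` defines a nontrivial
valuation ring of `Ω`. -/
theorem exists_embed_notMem (t : ball (0 : ℂ) D.radius) : ∃ g, D.embed g ∉ regularAt t := by
  let q : ℂ[X] := X - C (S.pt i + (t : ℂ) ^ p)
  have hq : aeval D.xFun q ≠ 0 := fun h =>
    X_sub_C_ne_zero _ ((injective_iff_map_eq_zero _).1 D.aeval_xFun_injective q h)
  refine ⟨(algebraMap (RatFunc ℂ) S.FunctionField (algebraMap ℂ[X] (RatFunc ℂ) q))⁻¹, ?_⟩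
  rw [map_inv₀, embed_algebraMap_poly]
  have h : algebraMap (DiskRing D.radius) (Frac D.radius) (aeval D.xFun q) ∈
      (regularAt t).nonunits := by
    refine mem_nonunits_regularAt.2 ⟨aeval D.xFun q, 1, ?_, one_ne_zero, by rw [map_one, mul_one]⟩
    rw [aeval_apply]
    change (X - C (S.pt i + (t : ℂ) ^ p)).eval (S.pt i + (t : ℂ) ^ p) = 0
    simp
  refine ((ValuationSubring.mem_nonunits_iff_or _).1 h).resolve_left ?_
  rwa [IsFractionRing.to_map_eq_zero_iff]

/-- The point of the curve with local coordinate `t`. -/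
def point (t : ball (0 : ℂ) D.radius) : Place S.FunctionField :=
  ofDisk D.embed D.exists_embed_notMem t

end LocalBranch

end SuperellipticDatum

/-! ### Galois action, exhaustion of the fibres, and the chart above `x_i` -/

namespace SuperellipticDatum

variable {p : ℕ} (S : SuperellipticDatum p) (i : Fin S.r) [hp : Fact p.Prime]

/-- The function `x` on the curve. -/
def x : S.FunctionField := algebraMap (RatFunc ℂ) S.FunctionField RatFunc.X

/-- The function `y ^ a / (x - x_i) ^ k`, with `a v_i = 1 + p k`: a uniformizer at the point
above `x_i`. -/
def unif : S.FunctionField :=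
  S.y ^ S.invExp i * (algebraMap (RatFunc ℂ) S.FunctionField
    (algebraMap ℂ[X] (RatFunc ℂ) (X - C (S.pt i))))⁻¹ ^ S.quoExp i

variable {S}

theorem algebraMap_poly_eq (q : ℂ[X]) :
    algebraMap (RatFunc ℂ) S.FunctionField (algebraMap ℂ[X] (RatFunc ℂ) q) = aeval S.x q := by
  rw [x, ← RatFunc.algebraMap_X, aeval_algebraMap_apply, aeval_algebraMap_apply, aeval_X_left_apply]

theorem isGalois : IsGalois (RatFunc ℂ) S.FunctionField := by
  have hprim : (primitiveRoots p (RatFunc ℂ)).Nonempty :=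
    ⟨_, (mem_primitiveRoots hp.out.pos).2
      ((Complex.isPrimitiveRoot_exp p hp.out.ne_zero).map_of_injective
      (algebraMap ℂ (RatFunc ℂ)).injective)⟩
  have hirr : Irreducible (X ^ p - C S.rhs) := (inferInstance : Fact (Irreducible S.eqn)).out
  have : IsSplittingField (RatFunc ℂ) S.FunctionField (X ^ p - C S.rhs) :=
    isSplittingField_AdjoinRoot_X_pow_sub_C hprim hirr
  exact isGalois_of_isSplittingField_X_pow_sub_C hprim hirr S.FunctionField

theorem finiteDimensional : FiniteDimensional (RatFunc ℂ) S.FunctionField :=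
  (AdjoinRoot.powerBasis (f := S.eqn) (Irreducible.ne_zero Fact.out)).finite

theorem y_ne_zero : S.y ≠ 0 := by
  intro h
  have h1 := S.y_pow
  rw [h, zero_pow hp.out.ne_zero] at h1
  exact S.rhs_ne_pow hp.out 0 (by
    rw [zero_pow hp.out.ne_zero]
    exact ((map_eq_zero _).1 h1.symm).symm)

/-- Every automorphism of `Ω_f` over `ℂ(x)` multiplies `y` by a `p`-th root of unity. -/
theorem exists_apply_y (σ : S.FunctionField ≃ₐ[RatFunc ℂ] S.FunctionField) :
    ∃ c : ℂ, c ^ p = 1 ∧ σ S.y = algebraMap ℂ S.FunctionField c * S.y := by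
  have hprim := Complex.isPrimitiveRoot_exp p hp.out.ne_zero
  have h : (σ S.y / S.y) ^ p = 1 := by
    rw [div_pow, ← map_pow, S.y_pow, AlgEquiv.commutes, div_self]
    rw [← S.y_pow]
    exact pow_ne_zero _ y_ne_zero
  have : NeZero p := ⟨hp.out.ne_zero⟩
  obtain ⟨k, -, hk⟩ := (hprim.map_of_injective
    (algebraMap ℂ S.FunctionField).injective).eq_pow_of_pow_eq_one h
  refine ⟨Complex.exp (2 * Real.pi * Complex.I / p) ^ k, ?_, ?_⟩
  · rw [pow_right_comm, hprim.pow_eq_one, one_pow]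
  · rw [map_pow, hk, div_mul_cancel₀ _ y_ne_zero]

theorem hasValue_algebraMap_poly {P : Place S.FunctionField} {c : ℂ} (h : P.HasValue S.x c)
    (q : ℂ[X]) :
    P.HasValue (algebraMap ℂ[X] S.FunctionField q) (q.eval c) := by
  have e : algebraMap ℂ[X] S.FunctionField q = aeval S.x q := by
    rw [← algebraMap_poly_eq, ← IsScalarTower.algebraMap_apply]
  rw [e]
  exact h.aeval q

/-- Points with the same `x`-coordinate are conjugate. -/
theorem exists_map_eq {P Q : Place S.FunctionField} {c : ℂ} (hP : P.HasValue S.x c)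
    (hQ : Q.HasValue S.x c) : ∃ σ : S.FunctionField ≃ₐ[RatFunc ℂ] S.FunctionField,
      Q = Place.map (σ.restrictScalars ℂ) P := by
  have := isGalois (S := S)
  have := finiteDimensional (S := S)
  -- The value of `x` determines the centre on `ℂ[x]`: it is the ideal of polynomials vanishing at
  -- `c`.
  have hctr : ∀ {R : Place S.FunctionField}, R.HasValue S.x c → ∀ q : ℂ[X],
      algebraMap ℂ[X] S.FunctionField q ∈ R.ring.nonunits ↔ q.eval c = 0 := by
    intro R hR q
    rw [← Place.hasValue_zero]
    exact ⟨fun h => (hasValue_algebraMap_poly hR q).eq h,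
      fun h => h ▸ hasValue_algebraMap_poly hR q⟩
  obtain ⟨σ, hσ⟩ := ValuationSubring.exists_comap_eq_of_center_eq (A := ℂ[X]) (K := RatFunc ℂ)
    P.ring Q.ring (fun q => (hasValue_algebraMap_poly hP q).mem)
    (fun q => (hasValue_algebraMap_poly hQ q).mem) (fun q => (hctr hP q).trans (hctr hQ q).symm)
    (X_sub_C_ne_zero c) ((hctr hP _).2 (by simp))
  exact ⟨σ, Place.ext_ring hσ⟩

theorem proj_eq_coe_iff {P : Place S.FunctionField} {c : ℂ} :
    S.proj P = (c : OnePoint ℂ) ↔ P.HasValue S.x c := Place.sphereValue_eq_coe_iff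

namespace LocalBranch

open Metric DiskRing Place

variable {i} (D : S.LocalBranch i)

/-- The uniformizer in terms of the local coordinate. -/
def unifFun : DiskRing D.radius :=
  ofFun (fun t => t * D.root (t ^ p) ^ S.invExp i)
    (.mul differentiableOn_id (D.differentiableOn_root_pow.pow _))

/-- Since `a * v_i = 1 + p * k`, the factor `t ^ (a * v_i)` of `y ^ a` is `t * (x - x_i) ^ k`.
Division leaves `t` times a nonvanishing function of `t ^ p`. -/
theorem embed_unif :
    D.embed (S.unif i) = algebraMap (DiskRing D.radius) (Frac D.radius) D.unifFun := by
  have hne : algebraMap (DiskRing D.radius) (Frac D.radius)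
      (aeval D.xFun (X - C (S.pt i))) ≠ 0 := by
    rw [Ne, IsFractionRing.to_map_eq_zero_iff]
    exact fun h => X_sub_C_ne_zero _ ((injective_iff_map_eq_zero _).1 D.aeval_xFun_injective _ h)
  have h : D.yFun ^ S.invExp i = D.unifFun * aeval D.xFun (X - C (S.pt i)) ^ S.quoExp i := by
    refine Subtype.ext (funext fun t => ?_)
    change ((t : ℂ) ^ S.v i * D.root ((t : ℂ) ^ p)) ^ S.invExp i =
      ((t : ℂ) * D.root ((t : ℂ) ^ p) ^ S.invExp i) *
        (aeval D.xFun (X - C (S.pt i))).1 t ^ S.quoExp i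
    rw [aeval_apply]
    change _ = _ * ((X - C (S.pt i)).eval (S.pt i + (t : ℂ) ^ p)) ^ S.quoExp i
    rw [eval_sub, eval_X, eval_C, add_sub_cancel_left, mul_pow, ← pow_mul, ← pow_mul,
      mul_comm (S.v i), S.invExp_mul_v i, pow_add, pow_one]
    ring
  rw [unif, map_mul, map_pow, map_pow, map_inv₀, embed_y, embed_algebraMap_poly, ← map_pow, h,
    map_mul, map_pow, mul_assoc, ← mul_pow, mul_inv_cancel₀ hne, one_pow, mul_one]

theorem hasValue_point {g : S.FunctionField} {f : DiskRing D.radius}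
    (h : D.embed g = algebraMap (DiskRing D.radius) (Frac D.radius) f)
    (t : ball (0 : ℂ) D.radius) : (D.point t).HasValue g (f.1 t) := by
  have := hasValue_ofDisk D.exists_embed_notMem (t := t) (g := g) (n := f) (d := 1) one_ne_zero
    (by rw [h, map_one, mul_one])
  rwa [show f.1 t / (1 : DiskRing D.radius).1 t = f.1 t from div_one _] at this

theorem hasValue_point_x (t : ball (0 : ℂ) D.radius) :
    (D.point t).HasValue S.x (S.pt i + (t : ℂ) ^ p) := by
  refine D.hasValue_point (f := D.xFun) ?_ t
  have := D.embed_algebraMap_poly X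
  rwa [RatFunc.algebraMap_X, aeval_X] at this

theorem hasValue_point_unif (t : ball (0 : ℂ) D.radius) :
    (D.point t).HasValue (S.unif i) (t * D.root ((t : ℂ) ^ p) ^ S.invExp i) :=
  D.hasValue_point D.embed_unif t

theorem norm_eq_one_of_pow_eq_one {c : ℂ} (hc : c ^ p = 1) : ‖c‖ = 1 := by
  rw [← pow_eq_one_iff_of_nonneg (norm_nonneg c) hp.out.ne_zero, ← norm_pow, hc, norm_one]

/-- The rotation by `c ^ a` fixes `t ^ p`, hence `x`, and multiplies `t ^ v_i` by `c ^ (a * v_i) =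
c`, hence `y` by `c`. It therefore agrees with `σ` on generators of `Ω`. -/
theorem embed_apply {σ : S.FunctionField ≃ₐ[RatFunc ℂ] S.FunctionField} {c : ℂ} (hc : c ^ p = 1)
    (hσ : σ S.y = algebraMap ℂ S.FunctionField c * S.y) (hc' : ‖c ^ S.invExp i‖ = 1)
    (g : S.FunctionField) : D.embed (σ g) = fracRotate hc' (D.embed g) := by
  have hcp : (c ^ S.invExp i) ^ p = 1 := by rw [pow_right_comm, hc, one_pow]
  have hcv : (c ^ S.invExp i) ^ S.v i = c := by
    rw [← pow_mul, S.invExp_mul_v i, pow_add, pow_one, pow_mul, hc, one_pow, mul_one]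
  have hx : precompRotate hc' D.xFun = D.xFun := by
    refine Subtype.ext (funext fun t => ?_)
    change S.pt i + (c ^ S.invExp i * (t : ℂ)) ^ p = S.pt i + (t : ℂ) ^ p
    rw [mul_pow, hcp, one_mul]
  have hy : precompRotate hc' D.yFun = algebraMap ℂ _ c * D.yFun := by
    refine Subtype.ext (funext fun t => ?_)
    change (c ^ S.invExp i * (t : ℂ)) ^ S.v i * D.root ((c ^ S.invExp i * (t : ℂ)) ^ p) =
      c * ((t : ℂ) ^ S.v i * D.root ((t : ℂ) ^ p))
    rw [mul_pow, mul_pow, hcp, hcv, one_mul, mul_assoc]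
  suffices h : ((D.embed : S.FunctionField →+* Frac D.radius).comp (σ : S.FunctionField →+* _)) =
      (fracRotate hc').comp (D.embed : S.FunctionField →+* Frac D.radius) from
    DFunLike.congr_fun h g
  refine AdjoinRoot.ringHom_ext (IsLocalization.ringHom_ext (nonZeroDivisors ℂ[X])
    (RingHom.ext fun q => ?_)) ?_
  · change D.embed (σ (algebraMap (RatFunc ℂ) S.FunctionField (algebraMap ℂ[X] (RatFunc ℂ) q))) =
      fracRotate hc' (D.embed (algebraMap (RatFunc ℂ) S.FunctionField
        (algebraMap ℂ[X] (RatFunc ℂ) q)))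
    rw [AlgEquiv.commutes, embed_algebraMap_poly, fracRotate_algebraMap,
      ← aeval_algHom_apply (precompRotate hc'), hx]
  · change D.embed (σ S.y) = fracRotate hc' (D.embed S.y)
    rw [hσ, map_mul, embed_y, fracRotate_algebraMap, hy, map_mul, AlgHom.commutes,
      IsScalarTower.algebraMap_apply ℂ (DiskRing D.radius) (Frac D.radius)]

theorem map_point {σ : S.FunctionField ≃ₐ[RatFunc ℂ] S.FunctionField} {c : ℂ} (hc : c ^ p = 1)
    (hσ : σ S.y = algebraMap ℂ S.FunctionField c * S.y) (hc' : ‖c ^ S.invExp i‖ = 1)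
    (t : ball (0 : ℂ) D.radius) :
    Place.map (σ.restrictScalars ℂ) (D.point t) = D.point (rotate hc' t) :=
  map_ofDisk D.exists_embed_notMem hc' (D.embed_apply hc hσ hc') t

/-- One place over `x_i + s` comes from a `p`-th root `t` of `s`. The others are its Galois
conjugates, and these correspond to rotations of `t`. -/
theorem exists_eq_point {Q : Place S.FunctionField} {s : ℂ} (hQ : Q.HasValue S.x (S.pt i + s))
    (hs : s ∈ ball (0 : ℂ) (D.radius ^ p)) :
    ∃ t : ball (0 : ℂ) D.radius, Q = D.point t ∧ (t : ℂ) ^ p = s := by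
  obtain ⟨t, ht⟩ := IsAlgClosed.exists_pow_nat_eq s hp.out.pos
  have htb : t ∈ ball (0 : ℂ) D.radius := by rwa [← D.pow_mem_ball_iff, ht]
  obtain ⟨σ, hσ⟩ := exists_map_eq (P := D.point ⟨t, htb⟩) (ht ▸ D.hasValue_point_x _) hQ
  obtain ⟨c, hc, hσy⟩ := exists_apply_y σ
  have hc' : ‖c ^ S.invExp i‖ = 1 := by
    rw [norm_pow, norm_eq_one_of_pow_eq_one (p := p) hc, one_pow]
  refine ⟨rotate hc' ⟨t, htb⟩, by rw [hσ, D.map_point hc hσy hc'], ?_⟩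
  change (c ^ S.invExp i * t) ^ p = s
  rw [mul_pow, pow_right_comm, hc, one_pow, one_mul, ht]

/-- Total ramification: `t ^ p = 0` has the single solution `t = 0`. -/
theorem eq_point_center {Q : Place S.FunctionField} (hQ : Q.HasValue S.x (S.pt i)) :
    Q = D.point (center D.radius) := by
  obtain ⟨t, rfl, ht⟩ := D.exists_eq_point (Q := Q) (s := 0) (by rwa [add_zero])
    (mem_ball_self (pow_pos D.radius_pos p))
  exact congrArg _ (Subtype.ext (pow_eq_zero_iff hp.out.ne_zero |>.1 ht))

/-- The local coordinate. -/
def coordinate (Q : Place S.FunctionField) : ℂ :=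
  Q.value (S.unif i) / D.root (Q.value S.x - S.pt i) ^ S.invExp i

/-- The nonvanishing factor of `unif` depends only on `x - x_i = t ^ p`, so it can be divided out
using values of functions in `Ω`. -/
theorem coordinate_point (t : ball (0 : ℂ) D.radius) : D.coordinate (D.point t) = t := by
  rw [coordinate, (D.hasValue_point_unif t).value_eq, (D.hasValue_point_x t).value_eq,
    add_sub_cancel_left, mul_div_cancel_right₀]
  exact pow_ne_zero _ (D.root_ne_zero _ (D.pow_mem_ball_iff.2 t.2))

theorem diskParam_eq_point (t : ball (0 : ℂ) D.radius) :
    diskParam D.exists_embed_notMem (t : ℂ) = D.point t := diskParam_of_mem _ t.2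

/-- The holomorphic chart around the point above `x_i`. -/
def chart : OpenPartialHomeomorph (Place S.FunctionField) ℂ where
  toFun := D.coordinate
  invFun := diskParam D.exists_embed_notMem
  source := {Q | ∃ s ∈ ball (0 : ℂ) (D.radius ^ p), Q.HasValue S.x (S.pt i + s)}
  target := ball 0 D.radius
  map_source' := by
    rintro Q ⟨s, hs, hQ⟩
    obtain ⟨t, rfl, -⟩ := D.exists_eq_point hQ hs
    rw [coordinate_point]
    exact t.2
  map_target' := by
    intro t ht
    rw [D.diskParam_eq_point ⟨t, ht⟩]
    exact ⟨t ^ p, D.pow_mem_ball_iff.2 ht, D.hasValue_point_x ⟨t, ht⟩⟩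
  left_inv' := by
    rintro Q ⟨s, hs, hQ⟩
    obtain ⟨t, rfl, -⟩ := D.exists_eq_point hQ hs
    rw [coordinate_point, diskParam_eq_point]
  right_inv' := by
    intro t ht
    rw [D.diskParam_eq_point ⟨t, ht⟩, coordinate_point]
  open_source := by
    -- The source is the preimage under `x` of a disk around `x_i` in the sphere.
    have h : IsOpen ((fun s : ℂ => ((S.pt i + s : ℂ) : OnePoint ℂ)) '' ball 0 (D.radius ^ p)) :=
      (OnePoint.isOpenMap_coe.comp (Homeomorph.addLeft (S.pt i)).isOpenMap) _ isOpen_ball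
    convert h.preimage (continuous_sphereValue S.x) using 1
    ext Q
    exact exists_congr fun s => and_congr_right fun _ => sphereValue_eq_coe_iff.symm.trans eq_comm
  open_target := isOpen_ball
  continuousOn_toFun := by
    rintro Q ⟨s, hs, hQ⟩
    obtain ⟨t, rfl, -⟩ := D.exists_eq_point hQ hs
    apply ContinuousAt.continuousWithinAt
    have hx := continuousAt_value (D.hasValue_point_x t)
    have hu := continuousAt_value (D.hasValue_point_unif t)
    have hmem := D.pow_mem_ball_iff.2 t.2
    have hval : (D.point t).value S.x - S.pt i = (t : ℂ) ^ p := by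
      rw [(D.hasValue_point_x t).value_eq, add_sub_cancel_left]
    have hr : ContinuousAt (fun Q : Place S.FunctionField => D.root (Q.value S.x - S.pt i))
        (D.point t) := by
      refine ContinuousAt.comp (g := D.root) ?_ (hx.sub continuousAt_const)
      rw [hval]
      exact (D.differentiableOn_root.differentiableAt (isOpen_ball.mem_nhds hmem)).continuousAt
    refine hu.div (hr.pow _) (pow_ne_zero _ ?_)
    rw [hval]
    exact D.root_ne_zero _ hmem
  continuousOn_invFun := fun t ht => (continuousAt_diskParam _ ht).continuousWithinAt

theorem isHolomorphicChart_chart : IsHolomorphicChart D.chart := fun _ _ hw hg =>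
  analyticAt_value_diskParam _ hw hg

variable {τ : S.FunctionField ≃ₐ[RatFunc ℂ] S.FunctionField} {ζ : ℂ} (hζ : ζ ^ p = 1)
  (hτ : τ S.y = algebraMap ℂ S.FunctionField ζ * S.y)

include hζ hτ

theorem chart_map {Q : Place S.FunctionField} (hQ : Q ∈ D.chart.source) :
    Place.map (τ.restrictScalars ℂ) Q ∈ D.chart.source ∧
      D.chart (Place.map (τ.restrictScalars ℂ) Q) = ζ ^ S.invExp i * D.chart Q := by
  have hc' : ‖ζ ^ S.invExp i‖ = 1 := by
    rw [norm_pow, norm_eq_one_of_pow_eq_one (p := p) hζ, one_pow]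
  obtain ⟨s, hs, hQ⟩ := hQ
  obtain ⟨t, rfl, -⟩ := D.exists_eq_point hQ hs
  rw [D.map_point hζ hτ hc']
  refine ⟨⟨_, D.pow_mem_ball_iff.2 (rotate hc' t).2, D.hasValue_point_x _⟩, ?_⟩
  change D.coordinate _ = _ * D.coordinate _
  rw [coordinate_point, coordinate_point]
  rfl

include D in
-- The chart `D.chart` realizes the multiplier `ζ ^ a`. The transition map from any other admissible
-- chart conjugates multiplication by `c` to multiplication by `ζ ^ a`, which forces equality.
theorem actsOnDiskBy_iff {P : Place S.FunctionField} (hP : P.HasValue S.x (S.pt i)) (c : ℂ) :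
    ActsOnDiskBy (τ.restrictScalars ℂ) P c ↔ c = ζ ^ S.invExp i := by
  have hPs : P ∈ D.chart.source :=
    ⟨0, mem_ball_self (pow_pos D.radius_pos p), by rwa [add_zero]⟩
  constructor
  · rintro ⟨φ, hφ, hPφ, hφP, ⟨ε, hε, hεφ⟩, hφτ⟩
    have hφ0 : φ.symm 0 = P := by rw [← hφP, φ.left_inv hPφ]
    have h0 : (0 : ℂ) ∈ φ.target := hφP ▸ φ.map_source hPφ
    have hunif : P.HasValue (S.unif i) 0 := by
      rw [D.eq_point_center hP]
      have := D.hasValue_point_unif (center D.radius)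
      rwa [show ((center D.radius : ball (0 : ℂ) D.radius) : ℂ) = 0 from rfl, zero_mul] at this
    -- The coordinate is an analytic expression in the values of `x` and `unif`, and both are
    -- analytic in the chart `φ`.
    have hT : AnalyticAt ℂ (fun w => D.chart (φ.symm w)) 0 := by
      have hx := hφ S.x 0 h0 (hφ0 ▸ hP.mem)
      have hu := hφ (S.unif i) 0 h0 (hφ0 ▸ hunif.mem)
      have hval : (φ.symm 0).value S.x - S.pt i = 0 := by rw [hφ0, hP.value_eq, sub_self]
      have hmem : (0 : ℂ) ∈ ball (0 : ℂ) (D.radius ^ p) := mem_ball_self (pow_pos D.radius_pos p)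
      have hr : AnalyticAt ℂ (fun w => D.root ((φ.symm w).value S.x - S.pt i)) 0 := by
        refine AnalyticAt.comp (g := D.root) ?_ (hx.sub analyticAt_const)
        rw [hval]
        exact D.differentiableOn_root.analyticOnNhd isOpen_ball _ hmem
      refine hu.div (hr.pow _) (pow_ne_zero _ ?_)
      rw [hval]
      exact D.root_ne_zero _ hmem
    have hev : ∀ᶠ w in nhds 0, w ∈ φ.target ∧ φ.symm w ∈ D.chart.source := by
      refine Filter.Eventually.and (φ.open_target.mem_nhds h0) ?_
      refine (φ.continuousAt_symm h0).eventually_mem (D.chart.open_source.mem_nhds ?_)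
      rwa [hφ0]
    refine eq_of_conj_mul hT hev ?_ ?_
    · rintro w ⟨hw, hw'⟩ z ⟨hz, hz'⟩ h
      exact φ.symm.injOn hw hz (D.chart.injOn hw' hz' h)
    · filter_upwards [hev] with w ⟨hw, hw'⟩
      rw [← (D.chart_map hζ hτ hw').2]
      have h1 := hφτ _ (φ.map_target hw)
      rw [φ.right_inv hw] at h1
      rw [← h1.2, φ.left_inv h1.1]
  · rintro rfl
    refine ⟨D.chart, D.isHolomorphicChart_chart, hPs, ?_, ⟨_, D.radius_pos, rfl⟩,
      fun Q hQ => D.chart_map hζ hτ hQ⟩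
    rw [D.eq_point_center hP]
    exact D.coordinate_point _

end LocalBranch

end SuperellipticDatum

/-! ### Adic completeness and Hensel's lemma in the completion -/

namespace IsDedekindDomain.HeightOneSpectrum

variable {R K : Type*} [CommRing R] [IsDedekindDomain R] [Field K] [Algebra R K]
  [IsFractionRing R K] (v : HeightOneSpectrum R)

theorem exists_valued_sub_lt_one (z : v.adicCompletion K) :
    ∃ g : K, Valued.v (z - algebraMap K (v.adicCompletion K) g) < 1 := by
  have hz : {y : v.adicCompletion K | Valued.v.restrict (y - z) < 1} ∈ nhds z :=
    Valued.mem_nhds.2 ⟨1, by simp⟩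
  obtain ⟨g, hg⟩ := (denseRange_algebraMap (R := R) (K := K) v).exists_mem_open isOpen_interior
    ⟨z, mem_interior_iff_mem_nhds.2 hz⟩
  refine ⟨g, ?_⟩
  have := interior_subset hg
  rw [Set.mem_ofPred_eq, Valuation.restrict_lt_one_iff] at this
  rwa [Valuation.map_sub_swap]

variable {v}

theorem mem_span_pow_iff {π : v.adicCompletionIntegers K}
    (hπ : Valued.v (π : v.adicCompletion K) = WithZero.exp (-1 : ℤ)) {n : ℕ}
    {a : v.adicCompletionIntegers K} :
    a ∈ Ideal.span {π} ^ n ↔ Valued.v (a : v.adicCompletion K) ≤ WithZero.exp (-(n : ℤ)) := by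
  have hπn : Valued.v ((π : v.adicCompletion K) ^ n) = WithZero.exp (-(n : ℤ)) := by
    rw [map_pow, hπ, ← WithZero.exp_nsmul]
    simp
  have hπ0 : (π : v.adicCompletion K) ^ n ≠ 0 := by
    intro h
    rw [h, map_zero] at hπn
    exact WithZero.exp_ne_zero hπn.symm
  rw [Ideal.span_singleton_pow, Ideal.mem_span_singleton']
  constructor
  · rintro ⟨b, rfl⟩
    change Valued.v ((b : v.adicCompletion K) * (π : v.adicCompletion K) ^ n) ≤ _
    rw [map_mul, hπn]
    exact mul_le_of_le_one_left zero_le b.2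
  · intro h
    refine ⟨⟨a / (π : v.adicCompletion K) ^ n, ?_⟩, Subtype.ext (div_mul_cancel₀ _ hπ0)⟩
    rw [mem_adicCompletionIntegers, map_div₀, hπn]
    exact div_le_one_of_le₀ h zero_le

/-- Powers of `π` cut out closed balls, so the `π`-adic topology is the valuation topology. The ring
of integers is closed in a complete field, hence complete. This gives access to Hensel's lemma. -/
theorem isAdicComplete_span {π : v.adicCompletionIntegers K}
    (hπ : Valued.v (π : v.adicCompletion K) = WithZero.exp (-1 : ℤ)) :
    IsAdicComplete (Ideal.span {π}) (v.adicCompletionIntegers K) := by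
  have : IsTopologicalRing (v.adicCompletionIntegers K) :=
    inferInstanceAs (IsTopologicalRing (v.adicCompletionIntegers K).toSubring)
  have hadic : IsAdic (Ideal.span {π}) := by
    rw [isAdic_iff]
    refine ⟨fun n => ?_, fun s hs => ?_⟩
    · have hπ0 : Valued.v.restrict ((π : v.adicCompletion K) ^ n) ≠ 0 := by
        rw [Valuation.ne_zero_iff]
        refine pow_ne_zero _ fun h => ?_
        rw [h, map_zero] at hπ
        exact WithZero.exp_ne_zero hπ.symm
      convert (Valued.isOpen_closedBall (v.adicCompletion K) hπ0).preimage continuous_subtype_val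
      ext a
      rw [SetLike.mem_coe, mem_span_pow_iff hπ, Set.mem_preimage, Set.mem_ofPred_eq,
        Valuation.restrict_le_iff, map_pow, hπ, ← WithZero.exp_nsmul]
      simp
    · obtain ⟨u, hu, hus⟩ := mem_nhds_subtype _ _ _ |>.1 hs
      obtain ⟨γ, hγ⟩ := Valued.mem_nhds_zero.1 hu
      have hγ0 : MonoidWithZeroHom.ValueGroup₀.embedding γ.1 ≠ 0 := by
        rw [Ne, map_eq_zero]
        exact γ.ne_zero
      obtain ⟨k, hk⟩ : ∃ k : ℤ, WithZero.exp k = _ := ⟨_, WithZero.exp_log hγ0⟩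
      -- The exponent `n` must satisfy `-n < k` strictly, that is `n ≥ 1 - k`.
      refine ⟨(1 - k).toNat, fun a ha => hus (hγ ?_)⟩
      rw [SetLike.mem_coe, mem_span_pow_iff hπ] at ha
      rw [Set.mem_ofPred_eq, Valuation.restrict_lt_iff_lt_embedding, ← hk]
      refine ha.trans_lt (WithZero.exp_lt_exp.2 ?_)
      omega
  have : IsUniformAddGroup (v.adicCompletionIntegers K) := 
    inferInstanceAs (IsUniformAddGroup (v.adicCompletionIntegers K).toSubring.toAddSubgroup)
  have hclosed : IsClosed (v.adicCompletionIntegers K : Set (v.adicCompletion K)) :=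
    Valued.isClosed_valuationSubring _
  have hc : CompleteSpace (v.adicCompletionIntegers K) := hclosed.completeSpace_coe
  have := hadic.isPrecomplete_iff.2 hc
  have := hadic.isHausdorff_iff.2 inferInstance
  exact ⟨⟩

/-- Units of the completion that are residually constant `p`-th powers are `p`-th powers. -/
theorem exists_pow_eq_of_valued_sub_lt_one {z d : v.adicCompletion K} {n : ℕ} (hn : n ≠ 0)
    (hn1 : Valued.v (n : v.adicCompletion K) = 1) (hd : Valued.v d = 1)
    (h : Valued.v (z - d ^ n) < 1) : ∃ s : v.adicCompletion K, s ^ n = z := by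
  obtain ⟨ϖ, hϖ⟩ := v.valuation_exists_uniformizer K
  have hϖ' : Valued.v (algebraMap K (v.adicCompletion K) ϖ) = WithZero.exp (-1 : ℤ) := by
    rw [← hϖ]
    exact valuedAdicCompletion_eq_valuation' v ϖ
  let π : v.adicCompletionIntegers K := ⟨algebraMap K (v.adicCompletion K) ϖ, by
    rw [mem_adicCompletionIntegers, hϖ', ← WithZero.exp_zero, WithZero.exp_le_exp]
    omega⟩
  have hπ : Valued.v (π : v.adicCompletion K) = WithZero.exp (-1 : ℤ) := hϖ'
  have := isAdicComplete_span hπ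
  let d' : v.adicCompletionIntegers K := ⟨d, hd.le⟩
  have hz : z ∈ v.adicCompletionIntegers K := by
    have := add_mem (show z - d ^ n ∈ v.adicCompletionIntegers K from h.le) (pow_mem d'.2 n)
    rwa [sub_add_cancel] at this
  let z' : v.adicCompletionIntegers K := ⟨z, hz⟩
  have heval : (X ^ n - C z').eval d' ∈ Ideal.span {π} := by
    rw [eval_sub, eval_pow, eval_X, eval_C, ← pow_one (Ideal.span {π}), mem_span_pow_iff hπ]
    change Valued.v (d ^ n - z) ≤ _
    rw [Valuation.map_sub_swap]
    -- The valuation is discrete, so being less than `1` means being at most `exp (-1)`. The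
    -- logarithm needs the zero case apart.
    rcases eq_or_ne (z - d ^ n) 0 with h0 | h0
    · rw [h0, map_zero]
      exact zero_le
    · have hne : Valued.v (z - d ^ n) ≠ 0 := (Valuation.ne_zero_iff _).2 h0
      rw [← WithZero.exp_log hne] at h ⊢
      rw [← WithZero.exp_zero, WithZero.exp_lt_exp] at h
      rw [WithZero.exp_le_exp]
      omega
  have hderiv : IsUnit ((X ^ n - C z').derivative.eval d') := by
    rw [derivative_sub, derivative_C, sub_zero, derivative_X_pow, eval_mul, eval_C, eval_pow,
      eval_X, adicCompletionIntegers.isUnit_iff_valued_eq_one]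
    change Valued.v ((n : v.adicCompletion K) * d ^ (n - 1)) = 1
    rw [map_mul, map_pow, hn1, hd, one_pow, one_mul]
  obtain ⟨s, hs, -⟩ := HenselianRing.is_henselian (I := Ideal.span {π}) (X ^ n - C z')
    (monic_X_pow_sub_C _ hn) d' heval (hderiv.map _)
  rw [IsRoot.def, eval_sub, eval_pow, eval_X, eval_C, sub_eq_zero] at hs
  exact ⟨s, congrArg Subtype.val hs⟩

end IsDedekindDomain.HeightOneSpectrum

/-! ### The local field at `x_i`, the fibre algebra and its Kummer symbols -/

namespace SuperellipticDatum

open IsDedekindDomain HeightOneSpectrum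

variable {p : ℕ} (S : SuperellipticDatum p) (i : Fin S.r)

theorem valued_algebraMap (g : RatFunc ℂ) :
    Valued.v (algebraMap (RatFunc ℂ) (S.LocalField i) g) = (S.prime i).valuation (RatFunc ℂ) g :=
  valuedAdicCompletion_eq_valuation' _ g

theorem mem_prime_iff {q : ℂ[X]} : q ∈ (S.prime i).asIdeal ↔ q.eval (S.pt i) = 0 := by
  change q ∈ Ideal.span {X - C (S.pt i)} ↔ _
  rw [Ideal.mem_span_singleton, dvd_iff_isRoot, IsRoot.def]

theorem valuation_eq_one {q : ℂ[X]} (hq : q.eval (S.pt i) ≠ 0) :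
    (S.prime i).valuation (RatFunc ℂ) (algebraMap ℂ[X] (RatFunc ℂ) q) = 1 := by
  rw [valuation_eq_one_iff_notMem, mem_prime_iff]
  exact hq

theorem valuation_X_sub_C :
    (S.prime i).valuation (RatFunc ℂ) (algebraMap ℂ[X] (RatFunc ℂ) (X - C (S.pt i))) =
      WithZero.exp (-1 : ℤ) := by
  rw [valuation_of_algebraMap]
  exact intValuation_singleton _ (X_sub_C_ne_zero _) rfl

theorem valuation_C {c : ℂ} (hc : c ≠ 0) :
    Valued.v (algebraMap (RatFunc ℂ) (S.LocalField i) (RatFunc.C c)) = 1 := by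
  rw [valued_algebraMap, ← RatFunc.algebraMap_C]
  exact S.valuation_eq_one i (by rwa [eval_C])

theorem valued_rhs : Valued.v (algebraMap (RatFunc ℂ) (S.LocalField i) S.rhs) =
    WithZero.exp (-(S.v i : ℤ)) := by
  rw [valued_algebraMap, rhs, S.rhsPoly_eq i, map_mul, map_mul, map_pow, map_pow,
    S.valuation_X_sub_C, S.valuation_eq_one i (S.eval_cofactor_ne_zero i), mul_one,
    ← WithZero.exp_nsmul]
  simp

/-- The residue field of `K_x` is `ℂ`. -/
theorem exists_valued_sub_C_lt_one {z : S.LocalField i} (hz : Valued.v z ≤ 1) :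
    ∃ c : ℂ, Valued.v (z - algebraMap (RatFunc ℂ) (S.LocalField i) (RatFunc.C c)) < 1 := by
  obtain ⟨g, hg⟩ := exists_valued_sub_lt_one (S.prime i) z
  have hg1 : (S.prime i).valuation (RatFunc ℂ) g ≤ 1 := by
    rw [← valued_algebraMap, ← sub_sub_cancel z (algebraMap (RatFunc ℂ) (S.LocalField i) g)]
    exact (Valuation.map_sub _ _ _).trans (max_le hz hg.le)
  obtain ⟨n, ⟨d, hd⟩, hnd⟩ := exists_primeCompl_mul_eq_of_integer (S.prime i) g hg1
  have hd0 : d.eval (S.pt i) ≠ 0 := fun h => hd ((S.mem_prime_iff i).2 h)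
  refine ⟨n.eval (S.pt i) / d.eval (S.pt i), ?_⟩
  set c := n.eval (S.pt i) / d.eval (S.pt i)
  rw [← sub_add_sub_cancel z (algebraMap (RatFunc ℂ) (S.LocalField i) g)]
  refine (Valuation.map_add _ _ _).trans_lt (max_lt hg ?_)
  rw [← map_sub, valued_algebraMap]
  have e : (g - RatFunc.C c) * algebraMap ℂ[X] (RatFunc ℂ) d =
      algebraMap ℂ[X] (RatFunc ℂ) (n - C c * d) := by
    rw [sub_mul, map_sub, map_mul, RatFunc.algebraMap_C]
    exact congrArg (· - _) hnd
  have h := congrArg ((S.prime i).valuation (RatFunc ℂ)) e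
  rw [map_mul, S.valuation_eq_one i hd0, mul_one] at h
  rw [h, valuation_lt_one_iff_mem, mem_prime_iff, eval_sub, eval_mul, eval_C,
    div_mul_cancel₀ _ hd0, sub_self]

/-- The residue of `z` is a nonzero complex number and so has an `n`-th root. It lifts by Hensel,
since `n` is a unit. -/
theorem exists_pow_eq {n : ℕ} (hn : n ≠ 0) {z : S.LocalField i} (hz : Valued.v z = 1) :
    ∃ s : S.LocalField i, s ^ n = z := by
  obtain ⟨c, hc⟩ := S.exists_valued_sub_C_lt_one i hz.le
  have hc0 : c ≠ 0 := by
    rintro rfl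
    rw [map_zero, map_zero, sub_zero, hz] at hc
    exact lt_irrefl _ hc
  obtain ⟨d, rfl⟩ := IsAlgClosed.exists_pow_nat_eq c (Nat.pos_of_ne_zero hn)
  refine exists_pow_eq_of_valued_sub_lt_one
    (d := algebraMap (RatFunc ℂ) (S.LocalField i) (RatFunc.C d)) hn ?_ ?_ ?_
  · have := S.valuation_C i (c := n) (Nat.cast_ne_zero.2 hn)
    rwa [map_natCast, map_natCast] at this
  · refine S.valuation_C i ?_
    rintro rfl
    rw [zero_pow hn] at hc0
    exact hc0 rfl
  · rwa [← map_pow, ← map_pow]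

variable [hp : Fact p.Prime]

/-- A `p`-th root of `f` in `K_x` would make `v_i` divisible by `p`. -/
theorem irreducible_local :
    Irreducible (X ^ p - C (algebraMap (RatFunc ℂ) (S.LocalField i) S.rhs)) := by
  refine X_pow_sub_C_irreducible_of_prime hp.out fun b hb => ?_
  have h := congrArg Valued.v hb
  rw [valued_rhs, map_pow] at h
  have hb0 : Valued.v b ≠ 0 := by
    intro h0
    rw [h0, zero_pow hp.out.ne_zero] at h
    exact WithZero.exp_ne_zero h.symm
  rw [← WithZero.exp_log hb0, ← WithZero.exp_nsmul, WithZero.exp_inj, nsmul_eq_mul] at h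
  refine Nat.not_dvd_of_pos_of_lt (S.v_pos i) (S.v_lt i) (Int.natCast_dvd_natCast.1 ?_)
  exact ⟨-WithZero.log (Valued.v b), by linarith⟩

/-- The field `K_x[T] / (T ^ p - f)` maps to `E_x` by sending `T` to `1 ⊗ y`. The map is injective
and both sides have dimension `p`. -/
theorem isField_localExtension : IsField (S.LocalExtension i) := by
  let q : (S.LocalField i)[X] := X ^ p - C (algebraMap (RatFunc ℂ) (S.LocalField i) S.rhs)
  have hq : Irreducible q := S.irreducible_local i
  have : Fact (Irreducible q) := ⟨hq⟩
  have := finiteDimensional (S := S)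
  have hy : (1 ⊗ₜ S.y : S.LocalExtension i) ^ p =
      algebraMap (S.LocalField i) (S.LocalExtension i)
        (algebraMap (RatFunc ℂ) (S.LocalField i) S.rhs) := by
    rw [Algebra.TensorProduct.tmul_pow, one_pow, S.y_pow, Algebra.TensorProduct.algebraMap_apply,
      ← Algebra.TensorProduct.tmul_one_eq_one_tmul]
    rfl
  let j : AdjoinRoot q →ₐ[S.LocalField i] S.LocalExtension i :=
    AdjoinRoot.liftAlgHom q (Algebra.ofId _ _) (1 ⊗ₜ S.y) (by
      simp only [q, eval₂_sub, eval₂_pow, eval₂_X, eval₂_C, hy]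
      exact sub_self _)
  have : Module.Finite (S.LocalField i) (AdjoinRoot q) :=
    (AdjoinRoot.powerBasis hq.ne_zero).finite
  have hrank : Module.finrank (S.LocalField i) (AdjoinRoot q) =
      Module.finrank (S.LocalField i) (S.LocalExtension i) := by
    rw [Module.finrank_baseChange, (AdjoinRoot.powerBasis hq.ne_zero).finrank,
      (AdjoinRoot.powerBasis (f := S.eqn) (Irreducible.ne_zero Fact.out)).finrank,
      AdjoinRoot.powerBasis_dim, AdjoinRoot.powerBasis_dim, eqn, natDegree_X_pow_sub_C,
      natDegree_X_pow_sub_C]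
  have hinj : Function.Injective j := j.toRingHom.injective
  have hbij : Function.Bijective j :=
    ⟨hinj, (LinearMap.injective_iff_surjective_of_finrank_eq_finrank (f := j.toLinearMap) hrank).1
      hinj⟩
  exact (AlgEquiv.ofBijective j hbij).symm.toMulEquiv.isField (Field.toIsField (AdjoinRoot q))

/-- The exponents were chosen so that `x - x_i` survives to the first power. Thus `unif` is an
explicit `p`-th root of a uniformizer of `K_x`. -/
theorem unif_pow : S.unif i ^ p = algebraMap (RatFunc ℂ) S.FunctionField
    (algebraMap ℂ[X] (RatFunc ℂ) ((X - C (S.pt i)) * S.cofactor i ^ S.invExp i)) := by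
  have hne : algebraMap (RatFunc ℂ) S.FunctionField
      (algebraMap ℂ[X] (RatFunc ℂ) (X - C (S.pt i))) ≠ 0 := by
    rw [Ne, map_eq_zero, IsFractionRing.to_map_eq_zero_iff]
    exact X_sub_C_ne_zero _
  rw [unif, mul_pow, pow_right_comm, S.y_pow, rhs, S.rhsPoly_eq i, ← pow_mul, inv_pow]
  rw [mul_inv_eq_iff_eq_mul₀ (pow_ne_zero _ hne)]
  simp only [← map_pow, ← map_mul]
  congr 2
  rw [mul_pow, ← pow_mul, mul_comm (S.v i), S.invExp_mul_v i, pow_add, pow_one,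
    mul_comm p]
  ring

/-- The `p`-th roots of a nonzero element in a domain containing `ℂ` differ by constants. -/
theorem _root_.exists_eq_algebraMap_mul_of_pow_eq {E : Type*} [CommRing E] [IsDomain E]
    (j : ℂ →+* E) {n : ℕ} (hn : 0 < n) {a b : E} (h : a ^ n = b ^ n) :
    ∃ c : ℂ, a = j c * b := by
  have hprim := (Complex.isPrimitiveRoot_exp n hn.ne').map_of_injective j.injective
  have : NeZero n := ⟨hn.ne'⟩
  have hprod := hprim.pow_sub_pow_eq_prod_sub_mul a b hn
  rw [h, sub_self, eq_comm, Finset.prod_eq_zero_iff] at hprod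
  obtain ⟨μ, hμ, hab⟩ := hprod
  obtain ⟨k, -, hk⟩ := hprim.eq_pow_of_pow_eq_one ((mem_nthRootsFinset hn _).1 hμ)
  exact ⟨_, by rw [map_pow, hk, ← sub_eq_zero, hab]⟩

/-- A Kummer symbol can be computed on a single root. -/
theorem _root_.isKummerSymbol_iff_of_apply_eq {K E : Type*} [Field K] [CommRing E] [IsDomain E]
    [Algebra K E] {n : ℕ} (hn : 0 < n) (j : ℂ →+* K) {g : E ≃ₐ[K] E} {a : K} (ha : a ≠ 0) {β₀ : E}
    (hβ₀ : β₀ ^ n = algebraMap K E a) {c₀ : ℂ} (hg : g β₀ = algebraMap K E (j c₀) * β₀) (c : ℂ) :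
    IsKummerSymbol n g a (j c) ↔ c = c₀ := by
  have hβ₀0 : β₀ ≠ 0 := by
    rintro rfl
    rw [zero_pow hn.ne'] at hβ₀
    exact ha ((map_eq_zero_iff _ (algebraMap K E).injective).1 hβ₀.symm)
  constructor
  · rintro ⟨-, h⟩
    have h1 := h β₀ hβ₀
    rw [hg] at h1
    exact (j.injective ((algebraMap K E).injective (mul_right_cancel₀ hβ₀0 h1))).symm
  · rintro rfl
    refine ⟨⟨β₀, hβ₀⟩, fun β hβ => ?_⟩
    -- Any other root is a constant multiple of `β₀`, and `g` fixes constants.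
    obtain ⟨c', rfl⟩ := exists_eq_algebraMap_mul_of_pow_eq ((algebraMap K E).comp j) hn
      (hβ.trans hβ₀.symm)
    rw [map_mul, hg, mul_left_comm, RingHom.comp_apply, AlgEquiv.commutes]

variable {S i} {τ : S.FunctionField ≃ₐ[RatFunc ℂ] S.FunctionField} {ζ : ℂ}
  (hτ : τ S.y = algebraMap ℂ S.FunctionField ζ * S.y)

include hτ

theorem apply_unif : τ (S.unif i) =
    algebraMap (RatFunc ℂ) S.FunctionField (RatFunc.C (ζ ^ S.invExp i)) * S.unif i := by
  rw [unif, map_mul, map_pow, map_pow, map_inv₀, AlgEquiv.commutes, hτ, mul_pow, mul_assoc,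
    map_pow, map_pow]
  rfl

/-- The quotient of `z` by the uniformizer `unif ^ p` is a unit, hence `s ^ p` with `s ∈ K_x`. So `s
⊗ unif` is a `p`-th root of `z`, on which `τ_x` acts as `τ` does on `unif`. -/
theorem isKummerSymbol_iff {z : S.LocalField i} (hz : S.IsUniformizer i z) (c : ℂ) :
    IsKummerSymbol p (S.localAut i τ) z
      (algebraMap (RatFunc ℂ) (S.LocalField i) (RatFunc.C c)) ↔ c = ζ ^ S.invExp i := by
  have hE := S.isField_localExtension i
  have : IsDomain (S.LocalExtension i) := hE.isDomain
  obtain ⟨w, hw'⟩ : ∃ w, w =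
      algebraMap ℂ[X] (RatFunc ℂ) ((X - C (S.pt i)) * S.cofactor i ^ S.invExp i) :=
    ⟨_, rfl⟩
  have hw : Valued.v (algebraMap (RatFunc ℂ) (S.LocalField i) w) = WithZero.exp (-1 : ℤ) := by
    rw [hw', valued_algebraMap, map_mul, map_mul, map_pow, map_pow, S.valuation_X_sub_C,
      S.valuation_eq_one i (S.eval_cofactor_ne_zero i), one_pow, mul_one]
  have hw0 : algebraMap (RatFunc ℂ) (S.LocalField i) w ≠ 0 := by
    intro h
    rw [h, map_zero] at hw
    exact WithZero.exp_ne_zero hw.symm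
  have hz0 : z ≠ 0 := by
    rintro rfl
    rw [IsUniformizer, map_zero] at hz
    exact WithZero.exp_ne_zero hz.symm
  obtain ⟨s, hs⟩ := S.exists_pow_eq i hp.out.ne_zero
    (z := z / algebraMap (RatFunc ℂ) (S.LocalField i) w) (by
      rw [map_div₀, hw, show Valued.v z = _ from hz, div_self WithZero.exp_ne_zero])
  have hswap : ∀ r : RatFunc ℂ,
      (1 ⊗ₜ algebraMap (RatFunc ℂ) S.FunctionField r : S.LocalExtension i) =
      algebraMap (S.LocalField i) _ (algebraMap (RatFunc ℂ) (S.LocalField i) r) := fun r => by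
    rw [Algebra.TensorProduct.algebraMap_apply, ← Algebra.TensorProduct.tmul_one_eq_one_tmul]
    rfl
  refine isKummerSymbol_iff_of_apply_eq hp.out.pos
    ((algebraMap (RatFunc ℂ) (S.LocalField i)).comp RatFunc.C)
    (β₀ := algebraMap (S.LocalField i) _ s * (1 ⊗ₜ S.unif i)) hz0 ?_ ?_ c
  · rw [mul_pow, Algebra.TensorProduct.tmul_pow, one_pow, S.unif_pow i, ← hw', hswap, ← map_pow,
      hs, ← map_mul, div_mul_cancel₀ _ hw0]
  · rw [map_mul, AlgEquiv.commutes, RingHom.comp_apply, ← hswap, mul_left_comm,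
      Algebra.TensorProduct.tmul_mul_tmul, one_mul, ← apply_unif hτ]
    rfl

end SuperellipticDatum

/-! ### Assembling the theorem -/

namespace SuperellipticDatum

variable {p : ℕ} [Fact p.Prime] {S : SuperellipticDatum p}

theorem galoisAction_y (χ : Multiplicative (ZMod p) →* rootsOfUnity p ℂ)
    (g : Multiplicative (ZMod p)) : S.galoisAction χ g S.y =
      algebraMap ℂ S.FunctionField ((χ g : ℂˣ) : ℂ) * S.y :=
  S.kummerHom_y (χ g)

theorem pow_val_eq_iff {ζ : ℂ} (hζ : IsPrimitiveRoot ζ p) (i : Fin S.r) (m : ZMod p) :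
    ζ ^ m.val = ζ ^ S.invExp i ↔ m = (S.v i : ZMod p)⁻¹ :=
  ⟨fun h => ZMod.val_injective p (hζ.pow_inj (ZMod.val_lt _) (ZMod.val_lt _) h),
    fun h => h ▸ rfl⟩

end SuperellipticDatum

end

theorem propositionP {p : ℕ} [Fact p.Prime] (S : SuperellipticDatum p)
    (χ : Multiplicative (ZMod p) →* rootsOfUnity p ℂ) (hχ : χ ≠ 1)
    (ζ : ℂ) (hζ : IsPrimitiveRoot ζ p)
    (g : Multiplicative (ZMod p)) (hg : ((χ g : ℂˣ) : ℂ) = ζ)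
    (τ : S.FunctionField ≃ₐ[RatFunc ℂ] S.FunctionField) (hτ : τ = S.galoisAction χ g)
    (i : Fin S.r) :
    IsField (S.LocalExtension i) ∧
    (∃! P : Place S.FunctionField, S.proj P = (S.pt i : OnePoint ℂ)) ∧
    Valued.v (algebraMap (RatFunc ℂ) (S.LocalField i) S.rhs) = WithZero.exp (-(S.v i : ℤ)) ∧
    ∃ ρ : ZMod p, ρ * (S.v i : ZMod p) = 1 ∧
      (∀ z : S.LocalField i, S.IsUniformizer i z →
        ∀ m : ZMod p, S.IsAlgebraicRotationNumber i τ ζ z m ↔ m = ρ) ∧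
      (∀ P : Place S.FunctionField, S.proj P = (S.pt i : OnePoint ℂ) →
        ∀ m : ZMod p, Place.ActsOnDiskBy (τ.restrictScalars ℂ) P (ζ ^ m.val) ↔ m = ρ) ∧
      (ζ = Complex.exp (2 * Real.pi * Complex.I / (p : ℂ)) →
        ∀ P : Place S.FunctionField, S.proj P = (S.pt i : OnePoint ℂ) →
          ∀ m : ZMod p,
            Place.IsAnalyticRotationNumber p (τ.restrictScalars ℂ) P m ↔ m = ρ) := by

  have hτy : τ S.y = algebraMap ℂ S.FunctionField ζ * S.y := by
    rw [hτ, S.galoisAction_y, hg]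
  obtain ⟨D⟩ := S.nonempty_localBranch i
  have hdisk : ∀ P : Place S.FunctionField, S.proj P = (S.pt i : OnePoint ℂ) → ∀ m : ZMod p,
      Place.ActsOnDiskBy (τ.restrictScalars ℂ) P (ζ ^ m.val) ↔ m = (S.v i : ZMod p)⁻¹ :=
    fun P hP m => (D.actsOnDiskBy_iff hζ.pow_eq_one hτy
      (SuperellipticDatum.proj_eq_coe_iff.1 hP) _).trans (S.pow_val_eq_iff hζ i m)
  refine ⟨S.isField_localExtension i, ⟨D.point (DiskRing.center D.radius), ?_, fun P hP =>
    D.eq_point_center (SuperellipticDatum.proj_eq_coe_iff.1 hP)⟩, S.valued_rhs i,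
    (S.v i : ZMod p)⁻¹, inv_mul_cancel₀ (S.v_ne_zero i), fun z hz m =>
      (SuperellipticDatum.isKummerSymbol_iff hτy hz _).trans (S.pow_val_eq_iff hζ i m), hdisk, ?_⟩
  · refine SuperellipticDatum.proj_eq_coe_iff.2 ?_
    have := D.hasValue_point_x (DiskRing.center D.radius)
    rwa [show ((DiskRing.center D.radius : Metric.ball (0 : ℂ) D.radius) : ℂ) = 0 from rfl,
      zero_pow (Fact.out : p.Prime).ne_zero, add_zero] at this
  · rintro rfl P hP m
    rw [← hdisk P hP m, Place.IsAnalyticRotationNumber, ← Complex.exp_nat_mul]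
    ring_nf
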